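/- Let $K$ be a field with at least $13$ elements, and let $S\subset\mathbb{P}^3$ be a smooth cubic surface over $K$ containing a pair of skew (i.e. disjoint) lines, both defined over $K$. For $B\subseteq S(K)$ put $B_0=B$, and let $B_{n+1}$ be the set of points $R\in S(K)$ such that either $R\in B_n$, or $\ell\cdot S=P+Q+R$ (intersection with multiplicities) for some line $\ell\not\subset S$ defined over $K$ and some, not necessarily distinct, $P,Q\in B_n$. Let $\operatorname{Span}(B)=\bigcup_{n\ge 0}B_n$, and $$r(S,K)=\min\{\#B : B\subseteq S(K),\ \operatorname{Span}(B)=S(K)\}.$$ A point of $S$ is called an Eckardt point if three distinct lines contained in $S$ (lines over the algebraic closure $\overline{K}$) meet in it. Then for every point $P\in S(K)$ that lies on one of the two given skew lines and is not an Eckardt point, one has $\operatorname{Span}(\{P\})=S(K)$. In particular, $r(S,K)=1$. -/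

import Mathlib

open MvPolynomial Module
open scoped LinearAlgebra.Projectivization

/-- The `K`-points of projective three-space. -/
abbrev ProjSpace3 (K : Type*) [Field K] : Type _ := ℙ K (Fin 4 → K)

/-- A line of projective three-space that is defined over `L`, given as a two-dimensional
linear subspace of `L ^ 4`. -/
def IsLine {L : Type*} [Field L] (l : Submodule L (Fin 4 → L)) : Prop :=
  finrank L l = 2

/-- The binary form `F (s u + t v)` in the variables `s = X 0` and `t = X 1`. -/
noncomputable def restrictForm {L : Type*} [Field L] (F : MvPolynomial (Fin 4) L)
    (u v : Fin 4 → L) : MvPolynomial (Fin 2) L :=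
  bind₁ (fun i => C (u i) * X 0 + C (v i) * X 1) F

/-- The line `l` (over `L`) is contained in the surface `F = 0`: the form `F` vanishes identically,
as a polynomial, on `l`. -/
def LineInZeroLocus {L : Type*} [Field L] (F : MvPolynomial (Fin 4) L)
    (l : Submodule L (Fin 4 → L)) : Prop :=
  IsLine l ∧ ∀ u ∈ l, ∀ v ∈ l, restrictForm F u v = 0

/-- A smooth cubic surface over `K` in projective three-space: a cubic form over `K` without
singular zeros over the algebraic closure of `K`. -/
structure SmoothCubicSurface (K : Type*) [Field K] where
  /-- the defining cubic form -/
  form : MvPolynomial (Fin 4) K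
  homogeneous : form.IsHomogeneous 3
  smooth : ∀ x : Fin 4 → AlgebraicClosure K, x ≠ 0 → aeval x form = 0 →
    ∃ i, aeval x (pderiv i form) ≠ 0

namespace SmoothCubicSurface

variable {K : Type*} [Field K] (S : SmoothCubicSurface K)

/-- The set `S(K)` of `K`-points of `S`. -/
def points : Set (ProjSpace3 K) :=
  {P | eval P.rep S.form = 0}

/-- The `K`-line `l` is contained in `S`. -/
def ContainsLine (l : Submodule K (Fin 4 → K)) : Prop :=
  LineInZeroLocus S.form l

/-- The `K`-point `P` is an Eckardt point of `S`: three distinct lines contained in `S` (lines over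
the algebraic closure of `K`) meet in `P`. -/
def IsEckardt (P : ProjSpace3 K) : Prop :=
  ∃ l : Fin 3 → Submodule (AlgebraicClosure K) (Fin 4 → AlgebraicClosure K),
    Function.Injective l ∧
    ∀ j, LineInZeroLocus (S.form.map (algebraMap K (AlgebraicClosure K))) (l j) ∧
      (fun i => algebraMap K (AlgebraicClosure K) (P.rep i)) ∈ l j

/-- The equality of cycles `l · S = P + Q + R`. In terms of coordinates `(s : t)` on `l`
with respect to a basis `u, v`, the restriction of the cubic form to `l` is, up to a nonzero
constant, the product of the three linear forms `y s - x t` vanishing at the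
points `(x : y)` that correspond to `P`, `Q` and `R`. In particular `l` is not contained
in `S`. -/
def IntersectionCycle (l : Submodule K (Fin 4 → K)) (P Q R : ProjSpace3 K) : Prop :=
  ∃ u v : Fin 4 → K, LinearIndependent K ![u, v] ∧ Submodule.span K {u, v} = l ∧
    ∃ p q r : Fin 2 → K,
      P.rep = p 0 • u + p 1 • v ∧ Q.rep = q 0 • u + q 1 • v ∧ R.rep = r 0 • u + r 1 • v ∧
      ∃ c : K, c ≠ 0 ∧ restrictForm S.form u v =
        C c * (C (p 1) * X 0 - C (p 0) * X 1) * (C (q 1) * X 0 - C (q 0) * X 1) *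
          (C (r 1) * X 0 - C (r 0) * X 1)

/-- One round of secant and tangent constructions (`B n` to `B (n + 1)`). -/
def secantTangentStep (B : Set (ProjSpace3 K)) : Set (ProjSpace3 K) :=
  {R | R ∈ S.points ∧ (R ∈ B ∨ ∃ l : Submodule K (Fin 4 → K), IsLine l ∧ ¬ S.ContainsLine l ∧
    ∃ P ∈ B, ∃ Q ∈ B, S.IntersectionCycle l P Q R)}

/-- The set of `K`-points generated from `B` by successive secant and tangent constructions
(used for `B ⊆ S(K)`). -/
def secantTangentSpan (B : Set (ProjSpace3 K)) : Set (ProjSpace3 K) :=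
  ⋃ n : ℕ, S.secantTangentStep^[n] B

/-- The number `r(S, K)`: the least cardinality of a subset of `S(K)` that
generates `S(K)`. -/
noncomputable def mordellWeilRank : Cardinal :=
  sInf {c | ∃ B : Set (ProjSpace3 K), B ⊆ S.points ∧ S.secantTangentSpan B = S.points ∧
    Cardinal.mk B = c}

end SmoothCubicSurface

/-! Everything rests on the expansion `cub (s x + t y) = s³ cub x + s²t pol x y + st² pol y x + t³
cub y`. For a zero `x`, the tangent plane `T_x` is the kernel of `pol x`, and a tangent line through
`y` meets the surface `S` doubly, and not more, at `x` when `pol y x ≠ 0`. The trilinear form need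
not be symmetric, so characteristics 2 and 3 need no separate treatment.

Filling a line `k` of `S`: for `p` on `k`, the plane `T_p` cuts `S` in `k` and a residual conic
`C_p` through `p`. If `C_p` is nonsingular (`Good`), tangent lines at `p` reach every point of `C_p`
off `k`. If `x` on `k` has `T_x ≠ T_p`, a line in `T_p` through `x` meets `S` further in two points
of `C_p`, and these generate `x`. A point with `T_x = T_p` is reached through a third point of `k`
(`Good.line_subset`). If `C_p` degenerates but `p` is not Eckardt, the section is a triangle, and
the side opposite `p` is filled before `k` (`NonEckardt.line_subset`).

The second skew line meets `C_p` in a non-Eckardt point, so it is filled too. A point off both lines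
lies on a unique transversal. If the transversal is not in `S`, the point is a third intersection.
If it is in `S` with a non-Eckardt foot, it is filled as a line. If both feet are Eckardt, `x` is
joined to points of `C_R` for a good `R` on the transversal; for most choices these points lie on
transversals outside `S` (`SecantClosed.transversal`).

Good points exist by counting. The discriminant of the residual conic is a quintic on the pencil of
planes through `k`, and the tangent plane depends quadratically on the point of `k`, so bad points
are zeros of a polynomial of degree at most 10. It is not identically zero, because smoothness over
the algebraic closure forces the discriminant to vanish only to first order. -/

/-! ### Cubic forms as diagonals of trilinear forms -/

namespace Trilinear

variable {K V : Type*} [Field K] [AddCommGroup V] [Module K V]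
  (Φ : V →ₗ[K] V →ₗ[K] V →ₗ[K] K)

/-- The cubic form `x ↦ Φ x x x`. -/
def cub (x : V) : K := Φ x x x

/-- The derivative at `x` in the direction `y` of the cubic form of `Φ`. -/
def pol (x y : V) : K := Φ x x y + Φ x y x + Φ y x x

/-- The full polarization of the cubic form of `Φ`. -/
def tri (x y z : V) : K :=
  Φ x y z + Φ x z y + Φ y x z + Φ y z x + Φ z x y + Φ z y x

variable {Φ}

theorem cub_add (x y : V) : cub Φ (x + y) = cub Φ x + pol Φ x y + pol Φ y x + cub Φ y := by
  simp only [cub, pol, map_add, LinearMap.add_apply]; ring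

theorem cub_smul (c : K) (x : V) : cub Φ (c • x) = c ^ 3 * cub Φ x := by
  simp only [cub, map_smul, LinearMap.smul_apply, smul_eq_mul]; ring

theorem pol_add_left (x y z : V) : pol Φ (x + y) z = pol Φ x z + pol Φ y z + tri Φ x y z := by
  simp only [tri, pol, map_add, LinearMap.add_apply]; ring

theorem pol_smul_left (c : K) (x y : V) : pol Φ (c • x) y = c ^ 2 * pol Φ x y := by
  simp only [pol, map_smul, LinearMap.smul_apply, smul_eq_mul]; ring

theorem pol_add_right (x y z : V) : pol Φ x (y + z) = pol Φ x y + pol Φ x z := by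
  simp only [pol, map_add, LinearMap.add_apply]; ring

theorem pol_smul_right (c : K) (x y : V) : pol Φ x (c • y) = c * pol Φ x y := by
  simp only [pol, map_smul, LinearMap.smul_apply, smul_eq_mul]; ring

theorem pol_self (x : V) : pol Φ x x = 3 * cub Φ x := by
  simp only [pol, cub]; ring

theorem tri_comm_left (x y z : V) : tri Φ x y z = tri Φ y x z := by
  simp only [tri]; ring

theorem tri_comm_right (x y z : V) : tri Φ x y z = tri Φ x z y := by
  simp only [tri]; ring

theorem tri_add_left (x y z w : V) : tri Φ (x + y) z w = tri Φ x z w + tri Φ y z w := by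
  simp only [tri, map_add, LinearMap.add_apply]; ring

theorem tri_add_mid (x y z w : V) : tri Φ x (y + z) w = tri Φ x y w + tri Φ x z w := by
  simp only [tri, map_add, LinearMap.add_apply]; ring

theorem tri_add_right (x y z w : V) : tri Φ x y (z + w) = tri Φ x y z + tri Φ x y w := by
  simp only [tri, map_add, LinearMap.add_apply]; ring

theorem tri_smul_left (c : K) (x y z : V) : tri Φ (c • x) y z = c * tri Φ x y z := by
  simp only [tri, map_smul, LinearMap.smul_apply, smul_eq_mul]; ring

theorem tri_smul_mid (c : K) (x y z : V) : tri Φ x (c • y) z = c * tri Φ x y z := by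
  simp only [tri, map_smul, LinearMap.smul_apply, smul_eq_mul]; ring

theorem tri_smul_right (c : K) (x y z : V) : tri Φ x y (c • z) = c * tri Φ x y z := by
  simp only [tri, map_smul, LinearMap.smul_apply, smul_eq_mul]; ring

theorem tri_self_left (x y : V) : tri Φ x x y = 2 * pol Φ x y := by
  simp only [tri, pol]; ring

theorem tri_self_outer (x y : V) : tri Φ x y x = 2 * pol Φ x y := by
  simp only [tri, pol]; ring

theorem tri_self_right (x y : V) : tri Φ x y y = 2 * pol Φ y x := by
  simp only [tri, pol]; ring

theorem pol_zero_left (x : V) : pol Φ 0 x = 0 := by simp [pol]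

theorem pol_zero_right (x : V) : pol Φ x 0 = 0 := by simp [pol]

variable (Φ) in
/-- The derivative of the cubic form at `x`, as a linear form. -/
def polHom (x : V) : V →ₗ[K] K where
  toFun := pol Φ x
  map_add' := pol_add_right x
  map_smul' c y := pol_smul_right c x y

theorem polHom_apply (x y : V) : polHom Φ x y = pol Φ x y := rfl

variable (Φ) in
/-- The cubic form of `Φ` has no singular zeros. -/
def Smooth : Prop := ∀ x : V, x ≠ 0 → cub Φ x = 0 → ∃ y, pol Φ x y ≠ 0

variable (Φ) in
/-- The cubic form of `Φ` vanishes identically on the two-dimensional subspace `k`. -/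
structure LineOn (k : Submodule K V) : Prop where
  finrank_eq : finrank K k = 2
  cub_eq : ∀ x ∈ k, cub Φ x = 0
  pol_eq : ∀ x ∈ k, ∀ y ∈ k, pol Φ x y = 0

theorem LineOn.tri_eq {k : Submodule K V} (hk : LineOn Φ k) {x y z : V} (hx : x ∈ k) (hy : y ∈ k)
    (hz : z ∈ k) : tri Φ x y z = 0 := by
  have h := pol_add_left (Φ := Φ) x y z
  rw [hk.pol_eq _ hx _ hz, hk.pol_eq _ hy _ hz, hk.pol_eq _ (k.add_mem hx hy) _ hz] at h
  simpa using h.symm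

/-! ### Linear algebra -/

theorem exists_eq_of_finrank_eq_two {k : Submodule K V} (hk : finrank K k = 2) {u v : V}
    (hu : u ∈ k) (hv : v ∈ k) (hind : ∀ a b : K, a • u + b • v = 0 → a = 0 ∧ b = 0) :
    ∀ x ∈ k, ∃ a b : K, x = a • u + b • v := by
  have hfin : FiniteDimensional K k := FiniteDimensional.of_finrank_pos (by omega)
  have hle : Submodule.span K {u, v} ≤ k :=
    Submodule.span_le.2 (Set.insert_subset hu (Set.singleton_subset_iff.2 hv))
  have hrank := finrank_span_eq_card (LinearIndependent.pair_iff.2 hind)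
  rw [Matrix.range_cons_cons_empty, Fintype.card_fin] at hrank
  have heq := Submodule.eq_of_le_of_finrank_eq hle (by omega)
  intro x hx
  rw [← heq, Submodule.mem_span_pair] at hx
  obtain ⟨a, b, h⟩ := hx
  exact ⟨a, b, h.symm⟩

theorem exists_basis_of_finrank_eq_two {k : Submodule K V} (hk : finrank K k = 2) {p : V}
    (hp : p ∈ k) (hp0 : p ≠ 0) :
    ∃ v ∈ k, (∀ x ∈ k, ∃ a b : K, x = a • p + b • v) ∧
      ∀ a b : K, a • p + b • v = 0 → a = 0 ∧ b = 0 := by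
  have hfin : FiniteDimensional K k := FiniteDimensional.of_finrank_pos (by omega)
  have hne : ¬ k ≤ K ∙ p := fun h => by
    have h1 := Submodule.finrank_mono h
    have h2 := finrank_span_singleton (K := K) hp0
    omega
  obtain ⟨v, hv, hvp⟩ := Set.not_subset.1 hne
  have hind : ∀ a b : K, a • p + b • v = 0 → a = 0 ∧ b = 0 := by
    intro a b h
    have hb : b = 0 := by
      by_contra hb
      refine hvp (Submodule.mem_span_singleton.2 ⟨-(b⁻¹ * a), ?_⟩)
      have : v = b⁻¹ • (b • v) := by rw [smul_smul, inv_mul_cancel₀ hb, one_smul]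
      rw [this, eq_neg_of_add_eq_zero_right h]
      module
    subst hb
    simp only [zero_smul, add_zero, smul_eq_zero, hp0, or_false] at h
    exact ⟨h, rfl⟩
  exact ⟨v, hv, exists_eq_of_finrank_eq_two hk hp hv hind, hind⟩

theorem finrank_ker_eq_three (h4 : finrank K V = 4) {φ : V →ₗ[K] K} (hφ : φ ≠ 0) :
    finrank K (LinearMap.ker φ) = 3 := by
  have : FiniteDimensional K V := FiniteDimensional.of_finrank_pos (by omega)
  have h := φ.finrank_range_add_finrank_ker
  have h1 : LinearMap.range φ = ⊤ := LinearMap.range_eq_top.2 (LinearMap.surjective hφ)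
  rw [h1, finrank_top, finrank_self, h4] at h
  omega

theorem exists_mem_ker_notMem (h4 : finrank K V = 4) {k : Submodule K V} (hk : finrank K k = 2)
    (φ : V →ₗ[K] K) : ∃ z ∉ k, φ z = 0 := by
  have : FiniteDimensional K V := FiniteDimensional.of_finrank_pos (by omega)
  have h3 : 3 ≤ finrank K (LinearMap.ker φ) := by
    by_cases hφ : φ = 0
    · subst hφ
      rw [LinearMap.ker_zero, finrank_top]; omega
    · exact (finrank_ker_eq_three h4 hφ).ge
  have hne : ¬ LinearMap.ker φ ≤ k := fun h => by
    have := Submodule.finrank_mono h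
    omega
  obtain ⟨z, hz, hzk⟩ := Set.not_subset.1 hne
  exact ⟨z, hzk, hz⟩

/-- Applied to the derivative at a zero whose tangent plane contains `k`: that plane is spanned by
`k` and any one further vector in it. -/
theorem exists_eq_add_smul_of_mem_ker (h4 : finrank K V = 4) {k : Submodule K V}
    (hk : finrank K k = 2) {φ : V →ₗ[K] K} (hφ : φ ≠ 0) (hφk : ∀ x ∈ k, φ x = 0) {w y : V}
    (hwk : w ∉ k) (hw : φ w = 0) (hy : φ y = 0) : ∃ x ∈ k, ∃ c : K, y = x + c • w := by
  have : FiniteDimensional K V := FiniteDimensional.of_finrank_pos (by omega)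
  have hle : k ⊔ K ∙ w ≤ LinearMap.ker φ :=
    sup_le hφk (by rwa [Submodule.span_singleton_le_iff_mem])
  have hlt : k < k ⊔ K ∙ w := by
    refine lt_of_le_of_ne le_sup_left fun h => hwk ?_
    rw [h]
    exact Submodule.mem_sup_right (Submodule.mem_span_singleton_self w)
  have h1 := Submodule.finrank_lt_finrank_of_lt hlt
  have h3 := finrank_ker_eq_three h4 hφ
  have heq := Submodule.eq_of_le_of_finrank_le hle (by omega)
  have hy' : y ∈ k ⊔ K ∙ w := heq ▸ hy
  obtain ⟨x, hx, z, hz, rfl⟩ := Submodule.mem_sup.1 hy'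
  obtain ⟨c, rfl⟩ := Submodule.mem_span_singleton.1 hz
  exact ⟨x, hx, c, rfl⟩

/-- The kernel of a functional has codimension at most one, so once it lies in a proper subspace it
equals it. A tangent plane contained in another coincides with it. -/
theorem eq_zero_of_ker_le {φ ψ : V →ₗ[K] K} (hψ : ψ ≠ 0) (h : ∀ y, φ y = 0 → ψ y = 0) {z : V}
    (hz : ψ z = 0) : φ z = 0 := by
  by_contra hφ
  refine hψ (LinearMap.ext fun w => ?_)
  have h1 := h (φ z • w - φ w • z) (by simp; ring)
  simpa [hz, hφ] using h1

theorem Smooth.polHom_ne_zero (hS : Smooth Φ) {x : V} (hx : x ≠ 0) (h : cub Φ x = 0) :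
    polHom Φ x ≠ 0 := fun h0 => by
  obtain ⟨y, hy⟩ := hS x hx h
  exact hy (by rw [← polHom_apply, h0, LinearMap.zero_apply])

end Trilinear

namespace Trilinear

variable {K V : Type*} [Field K] [AddCommGroup V] [Module K V]
  {Φ : V →ₗ[K] V →ₗ[K] V →ₗ[K] K}

/-! ### Sets of zeros closed under secants and tangents -/

variable (Φ) in
/-- A set of nonzero zeros of the cubic form that is closed under scaling and under the secant and
tangent constructions. -/
structure SecantClosed (B : V → Prop) : Prop where
  ne_zero : ∀ {x}, B x → x ≠ 0
  cub_eq : ∀ {x}, B x → cub Φ x = 0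
  smul : ∀ {x} {c : K}, B x → c ≠ 0 → B (c • x)
  secant : ∀ {x y} {a b : K}, B x → B y → a • x + b • y ≠ 0 → cub Φ (a • x + b • y) = 0 →
    (pol Φ x y ≠ 0 ∨ pol Φ y x ≠ 0) → B (a • x + b • y)
  tangent : ∀ {x y}, B x → y ≠ 0 → cub Φ y = 0 → pol Φ x y = 0 → pol Φ y x ≠ 0 → B y

variable (Φ) in
/-- Some tangent line at `p` meets the cubic surface in `p` with multiplicity exactly two. For `p`
on a line of the surface, this says that the residual conic in the tangent plane is
smooth at `p`. -/
def NonEckardt (p : V) : Prop := ∃ y, pol Φ p y = 0 ∧ pol Φ y p ≠ 0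

variable (Φ) in
/-- The residual conic of the line `k` in the tangent plane at `p` is nonsingular: it is smooth at
`p` and does not contain its tangent line at `p`. -/
structure Good (k : Submodule K V) (p : V) : Prop where
  mem : p ∈ k
  ne_zero : p ≠ 0
  nonEckardt : NonEckardt Φ p
  pol_ne_zero : ∀ y ∉ k, pol Φ p y = 0 → cub Φ y = 0 → pol Φ y p ≠ 0

variable (Φ) in
/-- The properties of a smooth cubic form over a large field that the generation argument uses:
it is smooth, no plane section contains a double line, and there are enough good points on
every line of the surface. -/
structure Ample : Prop where
  finrank_eq : finrank K V = 4
  smooth : Smooth Φ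
  exists_pol_ne_zero : ∀ k, LineOn Φ k → ∀ y ∉ k, ∃ x ∈ k, pol Φ x y ≠ 0
  exists_good : ∀ k, LineOn Φ k → ∀ u ∈ k, ∀ v ∈ k,
    (∀ a b : K, a • u + b • v = 0 → a = 0 ∧ b = 0) →
    ∀ c₀ c₁ : K, (c₁ ≠ 0 ∨ c₀ ≠ 0) → ∃ t : K, c₁ * t + c₀ ≠ 0 ∧ Good Φ k (t • u + v)

variable {B : V → Prop} {k : Submodule K V}

/-! ### Filling a line of the surface from one point -/

theorem SecantClosed.of_third (hB : SecantClosed Φ B) {x q : V} (hx0 : x ≠ 0) (hx : cub Φ x = 0)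
    (hxq : pol Φ x q ≠ 0) (hq : B q) (h : B (pol Φ q x • x + (-pol Φ x q) • q)) : B x := by
  have hcq := hB.cub_eq hq
  by_cases h0 : pol Φ q x = 0
  -- The line is tangent at `q`, so its cycle is `2q + x`.
  · exact hB.tangent hq hx0 hx h0 hxq
  · have he : x = (pol Φ q x)⁻¹ • (pol Φ q x • x + (-pol Φ x q) • q) +
        ((pol Φ q x)⁻¹ * pol Φ x q) • q := by
      rw [smul_add, smul_smul, inv_mul_cancel₀ h0]; module
    rw [he]
    refine hB.secant h hq (he ▸ hx0) (he ▸ hx) (Or.inr ?_)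
    rw [pol_add_right, pol_smul_right, pol_smul_right, pol_self, hcq]
    simpa using h0

theorem cub_third {x q : V} (hx : cub Φ x = 0) (hq : cub Φ q = 0) :
    cub Φ (pol Φ q x • x + (-pol Φ x q) • q) = 0 := by
  simp only [cub_add, cub_smul, pol_smul_left, pol_smul_right, hx, hq]; ring

/-- A conic nonsingular at `p` and not containing its tangent there meets each line of `T_p` through
`p` so that the cycle with the surface is exactly `2p + q`. -/
theorem Good.of_mem_conic (hB : SecantClosed Φ B) {p q : V} (hp : Good Φ k p) (hBp : B p)
    (hqk : q ∉ k) (hpq : pol Φ p q = 0) (hq : cub Φ q = 0) : B q :=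
  hB.tangent hBp (fun h => hqk (h ▸ k.zero_mem)) hq hpq (hp.pol_ne_zero q hqk hpq hq)

theorem LineOn.pol_ne_zero_of_tangent_ne (hk : LineOn Φ k) (h4 : finrank K V = 4)
    (hS : Smooth Φ) {p x q : V} (hp : p ∈ k) (hp0 : p ≠ 0) (hx : x ∈ k) (hqk : q ∉ k)
    (hpq : pol Φ p q = 0) (hne : ∃ y, pol Φ p y = 0 ∧ pol Φ x y ≠ 0) : pol Φ x q ≠ 0 := by
  obtain ⟨y, hpy, hxy⟩ := hne
  obtain ⟨z, hz, c, rfl⟩ := exists_eq_add_smul_of_mem_ker h4 hk.finrank_eq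
    (hS.polHom_ne_zero hp0 (hk.cub_eq p hp)) (fun z hz => hk.pol_eq p hp z hz) hqk hpq hpy
  rw [pol_add_right, pol_smul_right, hk.pol_eq x hx z hz, zero_add] at hxy
  exact right_ne_zero_of_mul hxy

/-- The line through `x` and a point `q` of the residual conic at `p` stays in the tangent plane at
`p`. Its third point is again on that conic, hence already reached. Distinct tangent planes
guarantee that the line `xq` is transverse at `x`. -/
theorem Good.of_tangent_ne (hB : SecantClosed Φ B) (hk : LineOn Φ k) (h4 : finrank K V = 4)
    (hS : Smooth Φ) {p x : V} (hp : Good Φ k p) (hBp : B p) (hx : x ∈ k)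
    (hne : ∃ y, pol Φ p y = 0 ∧ pol Φ x y ≠ 0) : B x := by
  have hx0 : x ≠ 0 := by
    rintro rfl
    obtain ⟨y, -, hy⟩ := hne
    exact hy (pol_zero_left y)
  obtain ⟨y, hpy, hyp⟩ := hp.nonEckardt
  have hyk : y ∉ k := fun h => hyp (hk.pol_eq y h p hp.mem)
  have hcp := hk.cub_eq p hp.mem
  have hpp := hk.pol_eq p hp.mem p hp.mem
  -- The point other than `p` where the tangent line `py` meets the surface: on it the form reduces
  -- to `αβ² pol y p + β³ cub y`.
  set q := (-cub Φ y) • p + pol Φ y p • y with hq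
  have hqk : q ∉ k := fun h => hyk <| by
    rwa [hq, k.add_mem_iff_right (k.smul_mem _ hp.mem), k.smul_mem_iff hyp] at h
  have hpq : pol Φ p q = 0 := by
    rw [hq, pol_add_right, pol_smul_right, pol_smul_right, hpp, hpy]; ring
  have hcq : cub Φ q = 0 := by
    simp only [hq, cub_add, cub_smul, pol_smul_left, pol_smul_right, hcp, hpy]; ring
  have hxq := hk.pol_ne_zero_of_tangent_ne h4 hS hp.mem hp.ne_zero hx hqk hpq hne
  have hcx := hk.cub_eq x hx
  refine hB.of_third hx0 hcx hxq (hp.of_mem_conic hB hBp hqk hpq hcq) ?_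
  refine hp.of_mem_conic hB hBp (fun h => hqk ?_) ?_ (cub_third hcx hcq)
  · rwa [k.add_mem_iff_right (k.smul_mem _ hx), k.smul_mem_iff (neg_ne_zero.2 hxq)] at h
  · rw [pol_add_right, pol_smul_right, pol_smul_right, hpq, hk.pol_eq p hp.mem x hx]; ring

/-- Two points of `k` may share a tangent plane, and then the conic at one says nothing about the
other. A good point of `k` with a different tangent plane serves as intermediary. -/
theorem Good.line_subset (hB : SecantClosed Φ B) (hk : LineOn Φ k) (hΦ : Ample Φ) {p : V}
    (hp : Good Φ k p) (hBp : B p) : ∀ x ∈ k, x ≠ 0 → B x := by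
  have h4 := hΦ.finrank_eq
  have hS := hΦ.smooth
  intro x hx hx0
  by_cases hne : ∃ y, pol Φ p y = 0 ∧ pol Φ x y ≠ 0
  · exact hp.of_tangent_ne hB hk h4 hS hBp hx hne
  push Not at hne
  obtain ⟨v, hv, hspan, hind⟩ := exists_basis_of_finrank_eq_two hk.finrank_eq hp.mem hp.ne_zero
  obtain ⟨y, hyk, hpy⟩ := exists_mem_ker_notMem h4 hk.finrank_eq (polHom Φ p)
  rw [polHom_apply] at hpy
  obtain ⟨w, hw, hwy⟩ := hΦ.exists_pol_ne_zero k hk y hyk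
  obtain ⟨a, b, rfl⟩ := hspan w hw
  have hc : tri Φ p v y ≠ 0 ∨ pol Φ v y ≠ 0 := by
    by_contra! h
    apply hwy
    simp only [pol_add_left, pol_smul_left, tri_smul_left, tri_smul_mid, hpy, h.1, h.2]; ring
  -- Since `pol p y = 0`, the value `pol (t p + v) y` is linear in `t`. Avoiding its root keeps `y`
  -- out of the new tangent plane.
  obtain ⟨t, ht, hg⟩ := hΦ.exists_good k hk p hp.mem v hv hind _ _ hc
  have hgy : pol Φ (t • p + v) y ≠ 0 := by
    simp only [pol_add_left, pol_smul_left, tri_smul_left, hpy]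
    convert ht using 1; ring
  have hBg := hp.of_tangent_ne hB hk h4 hS hBp hg.mem ⟨y, hpy, hgy⟩
  refine hg.of_tangent_ne hB hk h4 hS hBg hx ?_
  by_contra! h
  exact hgy (eq_zero_of_ker_le (φ := polHom Φ (t • p + v)) (ψ := polHom Φ x)
    (hS.polHom_ne_zero hx0 (hk.cub_eq x hx)) h (hne y hpy))

theorem lineOn_span_pair {u v : V} (hind : ∀ a b : K, a • u + b • v = 0 → a = 0 ∧ b = 0)
    (hu : cub Φ u = 0) (huv : pol Φ u v = 0) (hvu : pol Φ v u = 0) (hv : cub Φ v = 0) :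
    LineOn Φ (Submodule.span K {u, v}) where
  finrank_eq := by
    have := finrank_span_eq_card (LinearIndependent.pair_iff.2 hind)
    rwa [Matrix.range_cons_cons_empty, Fintype.card_fin] at this
  cub_eq x hx := by
    obtain ⟨a, b, rfl⟩ := Submodule.mem_span_pair.1 hx
    simp only [cub_add, cub_smul, pol_smul_left, pol_smul_right, hu, hv, huv, hvu]; ring
  pol_eq x hx y hy := by
    obtain ⟨a, b, rfl⟩ := Submodule.mem_span_pair.1 hx
    obtain ⟨c, d, rfl⟩ := Submodule.mem_span_pair.1 hy
    simp only [pol_add_left, pol_add_right, pol_smul_left, pol_smul_right,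
      tri_smul_left, tri_smul_mid, tri_self_outer, tri_self_right, pol_self,
      hu, hv, huv, hvu]
    ring

/-- If the residual conic splits, one component passes through `p` and the other does not, so with
`k` they form a triangle with vertices `p`, `p'` (on `k`) and `M`. Tangents at `p` reach the side
`Mp'`, and tangents at `M` then reach `k`. -/
theorem NonEckardt.line_subset (hB : SecantClosed Φ B) (hk : LineOn Φ k) (hΦ : Ample Φ) {p : V}
    (hpk : p ∈ k) (hp : NonEckardt Φ p) (hBp : B p) : ∀ x ∈ k, x ≠ 0 → B x := by
  have h4 := hΦ.finrank_eq
  have hS := hΦ.smooth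
  have hp0 := hB.ne_zero hBp
  by_cases hg : Good Φ k p
  · exact hg.line_subset hB hk hΦ hBp
  obtain ⟨m, hmk, hpm, hm, hmp⟩ : ∃ m ∉ k, pol Φ p m = 0 ∧ cub Φ m = 0 ∧ pol Φ m p = 0 := by
    by_contra! h
    exact hg ⟨hpk, hp0, hp, h⟩
  obtain ⟨v, hv, hspan, hind⟩ := exists_basis_of_finrank_eq_two hk.finrank_eq hpk hp0
  have hcp := hk.cub_eq p hpk
  have hcv := hk.cub_eq v hv
  have hpv := hk.pol_eq p hpk v hv
  have hvp := hk.pol_eq v hv p hpk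
  obtain ⟨b, hb⟩ : ∃ b, tri Φ p v m = b := ⟨_, rfl⟩
  obtain ⟨c, hc⟩ : ∃ c, pol Φ v m = c := ⟨_, rfl⟩
  obtain ⟨e, he⟩ : ∃ e, pol Φ m v = e := ⟨_, rfl⟩
  have hb2 : tri Φ p m v = b := by rw [tri_comm_right, hb]
  have hb3 : tri Φ v m p = b := by rw [tri_comm_right, tri_comm_left, hb]
  -- Otherwise every tangent line at `p` would have contact at least three there.
  have hb0 : b ≠ 0 := by
    rintro rfl
    obtain ⟨y, hpy, hyp⟩ := hp
    obtain ⟨x, hx, s, rfl⟩ := exists_eq_add_smul_of_mem_ker h4 hk.finrank_eq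
      (hS.polHom_ne_zero hp0 hcp) (fun z hz => hk.pol_eq p hpk z hz) hmk hpm hpy
    obtain ⟨r, r', rfl⟩ := hspan x hx
    apply hyp
    simp only [pol_add_left, pol_smul_left, tri_add_left, tri_smul_left, tri_smul_mid,
      tri_self_outer, pol_self, hcp, hpv, hvp, hmp, hb3, hpm]
    ring
  -- `p'` and `M` are the points where the component missing `p` meets `k` and the line `pm`.
  set p' := (-c) • p + b • v with hp'
  set M := (-e) • p + b • m with hM
  have hp'k : p' ∈ k := k.add_mem (k.smul_mem _ hpk) (k.smul_mem _ hv)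
  have hMk : M ∉ k := fun h => hmk <| by
    rwa [hM, k.add_mem_iff_right (k.smul_mem _ hpk), k.smul_mem_iff hb0] at h
  have hpM : pol Φ p M = 0 := by
    simp only [hM, pol_add_right, pol_smul_right, pol_self, hcp, hpm]; ring
  have hMp : pol Φ M p = 0 := by
    simp only [hM, pol_add_left, pol_smul_left, tri_smul_left, tri_smul_mid, pol_self, hcp, hmp,
      tri_self_outer, hpm]
    ring
  have hcM : cub Φ M = 0 := by
    simp only [hM, cub_add, cub_smul, pol_smul_left, pol_smul_right, hcp, hpm, hm, hmp]; ring
  have hp'M : pol Φ p' M = 0 := by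
    simp only [hp', hM, pol_add_left, pol_smul_left, pol_add_right, pol_smul_right, tri_smul_left,
      tri_smul_mid, tri_self_outer, pol_self, hcp, hpm, hvp, hc, hpv, hb]
    ring
  have hMp' : pol Φ M p' = 0 := by
    simp only [hp', hM, pol_add_left, pol_smul_left, pol_add_right, pol_smul_right, tri_smul_left,
      tri_smul_mid, tri_self_outer, pol_self, hcp, hpm, hpv, hb2, he, hmp]
    ring
  have hT : tri Φ p p' M = b ^ 3 := by
    simp only [hp', hM, tri_add_right, tri_add_mid, tri_smul_right, tri_smul_mid, tri_self_left,
      tri_self_outer, pol_add_right, pol_smul_right, pol_self, hcp, hpm, hpv, hb]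
    ring
  have hcp' := hk.cub_eq p' hp'k
  have hpp' := hk.pol_eq p hpk p' hp'k
  have hp'p := hk.pol_eq p' hp'k p hpk
  have hT2 : tri Φ M p' p = b ^ 3 := by
    rw [tri_comm_left, tri_comm_right, tri_comm_left, hT]
  have hind' : ∀ r s : K, r • M + s • p' = 0 → r = 0 ∧ s = 0 := by
    intro r s h
    have hr : r = 0 := by
      by_contra hr
      refine hMk ((k.smul_mem_iff hr).1 ?_)
      rw [eq_neg_of_add_eq_zero_left h]
      exact k.neg_mem (k.smul_mem _ hp'k)
    subst hr
    refine ⟨rfl, ?_⟩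
    have := hind (-(s * c)) (s * b) (by rw [← h, hp']; module)
    exact (mul_eq_zero.1 this.2).resolve_right hb0
  have hm' := lineOn_span_pair hind' hcM hMp' hp'M hcp'
  have hMm : M ∈ Submodule.span K {M, p'} := Submodule.subset_span (by simp)
  have hp'm : p' ∈ Submodule.span K {M, p'} := Submodule.subset_span (by simp)
  have hp'0 : p' ≠ 0 := fun h => one_ne_zero (hind' 0 1 (by simp [h])).2
  -- The linear condition is `t ≠ 0`: at the vertex `p'` the tangent line at `p` would be `k`
  -- itself.
  obtain ⟨t, ht, hgt⟩ := hΦ.exists_good _ hm' M hMm p' hp'm hind' 0 1 (Or.inl one_ne_zero)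
  have ht0 : t ≠ 0 := by simpa using ht
  have hBt : B (t • M + p') := by
    refine hB.tangent hBp hgt.ne_zero (hm'.cub_eq _ hgt.mem) ?_ ?_
    · rw [pol_add_right, pol_smul_right, hpM, hpp']; ring
    · rw [pol_add_left, pol_smul_left, hMp, hp'p, tri_smul_left, hT2]
      simpa using ⟨ht0, hb0⟩
  have hline := hgt.line_subset hB hm' hΦ hBt
  have hBM := hline M hMm fun h => hMk (h ▸ k.zero_mem)
  have hBp' := hline p' hp'm hp'0
  intro x hx hx0
  obtain ⟨r, s, rfl⟩ : ∃ r s : K, x = r • p + s • p' := by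
    obtain ⟨r, s, rfl⟩ := hspan x hx
    refine ⟨r + s * b⁻¹ * c, s * b⁻¹, ?_⟩
    rw [hp']
    match_scalars <;> field_simp
    ring
  by_cases hr : r = 0
  · subst hr
    have hs : s ≠ 0 := by rintro rfl; simp at hx0
    simpa using hB.smul hBp' hs
  by_cases hs : s = 0
  · subst hs
    simpa using hB.smul hBp hr
  -- Away from both vertices on `k`, the line `Mx` has cycle `2M + x`, since the cubic on the plane
  -- is `b³` times the product of the three coordinates.
  refine hB.tangent hBM hx0 (hk.cub_eq _ hx) ?_ ?_
  · rw [pol_add_right, pol_smul_right, pol_smul_right, hMp, hMp']; ring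
  · simp only [pol_add_left, pol_smul_left, hpM, hp'M, tri_smul_left, tri_smul_mid, hT]
    simp [hr, hs, hb0]

/-! ### Passing from a line to a skew line -/

theorem exists_good (hΦ : Ample Φ) (hk : LineOn Φ k) : ∃ p, Good Φ k p := by
  have hfin : 0 < finrank K k := by rw [hk.finrank_eq]; norm_num
  have : Nontrivial k := Module.nontrivial_of_finrank_pos hfin
  obtain ⟨⟨u, hu⟩, hu0⟩ := exists_ne (0 : k)
  obtain ⟨v, hv, -, hind⟩ := exists_basis_of_finrank_eq_two hk.finrank_eq hu
    (fun h => hu0 (Subtype.ext h))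
  obtain ⟨t, -, ht⟩ := hΦ.exists_good k hk u hu v hv hind 0 1 (Or.inl one_ne_zero)
  exact ⟨_, ht⟩

theorem exists_mem_ker_of_finrank_eq_two {l : Submodule K V} (hl : finrank K l = 2)
    (φ : V →ₗ[K] K) : ∃ x ∈ l, x ≠ 0 ∧ φ x = 0 := by
  have hfin : FiniteDimensional K l := FiniteDimensional.of_finrank_pos (by omega)
  have h := (φ ∘ₗ l.subtype).finrank_range_add_finrank_ker
  have h1 := (LinearMap.range (φ ∘ₗ l.subtype)).finrank_le
  rw [finrank_self] at h1
  have : Nontrivial (LinearMap.ker (φ ∘ₗ l.subtype)) :=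
    Module.nontrivial_of_finrank_pos (R := K) (by omega)
  obtain ⟨⟨x, hx⟩, hx0⟩ := exists_ne (0 : LinearMap.ker (φ ∘ₗ l.subtype))
  exact ⟨x, x.2, fun h => hx0 (Subtype.ext (Subtype.ext h)), hx⟩

/-- The tangent plane at a good `p` on `k` meets `l` in a point `r` of the residual conic. If `y` is
where `T_r` meets `k`, the line `ry` cannot lie on the surface, for it would be a component of that
nonsingular conic. So `ry` has contact exactly two at `r`. -/
theorem exists_nonEckardt_of_skew (hB : SecantClosed Φ B) (hk : LineOn Φ k) (hΦ : Ample Φ)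
    {l : Submodule K V} (hl : LineOn Φ l) (hskew : Disjoint k l)
    (hBk : ∀ x ∈ k, x ≠ 0 → B x) : ∃ r ∈ l, B r ∧ NonEckardt Φ r := by
  have h4 := hΦ.finrank_eq
  have hS := hΦ.smooth
  obtain ⟨p, hp⟩ := exists_good hΦ hk
  obtain ⟨r, hr, hr0, hpr⟩ := exists_mem_ker_of_finrank_eq_two hl.finrank_eq (polHom Φ p)
  rw [polHom_apply] at hpr
  have hrk : r ∉ k := fun h => hr0 (Submodule.disjoint_def.1 hskew r h hr)
  have hcr := hl.cub_eq r hr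
  refine ⟨r, hr, hp.of_mem_conic hB (hBk p hp.mem hp.ne_zero) hrk hpr hcr, ?_⟩
  obtain ⟨y, hy, hy0, hry⟩ := exists_mem_ker_of_finrank_eq_two hk.finrank_eq (polHom Φ r)
  rw [polHom_apply] at hry
  refine ⟨y, hry, fun hyr => ?_⟩
  obtain ⟨v, hv, hspan, hind⟩ := exists_basis_of_finrank_eq_two hk.finrank_eq hy hy0
  obtain ⟨s, t, hst⟩ := hspan p hp.mem
  have hpr' := hp.pol_ne_zero r hrk hpr hcr
  have hpr2 := hpr
  rw [hst, pol_add_left, pol_smul_left, pol_smul_left, hyr, tri_smul_left, tri_smul_mid] at hpr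
  rw [hst, pol_add_right, pol_smul_right, pol_smul_right, hry] at hpr'
  have ht : t ≠ 0 := by rintro rfl; simp at hpr'
  have hrel : t * pol Φ v r + s * tri Φ y v r = 0 := by
    have : t * (t * pol Φ v r + s * tri Φ y v r) = 0 := by linear_combination hpr
    exact (mul_eq_zero.1 this).resolve_left ht
  -- In this case the plane through `k` and `r` would be tangent along all of `k`.
  by_cases hb : tri Φ y v r = 0
  · obtain ⟨x, hx, hxr⟩ := hΦ.exists_pol_ne_zero k hk r hrk
    obtain ⟨a, b, rfl⟩ := hspan x hx
    have hvr : pol Φ v r = 0 := by simpa [hb, ht] using hrel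
    apply hxr
    simp only [pol_add_left, pol_smul_left, tri_smul_left, tri_smul_mid, hyr, hb, hvr]; ring
  · have hcy := hk.cub_eq y hy
    have hyp := hk.pol_eq y hy p hp.mem
    have hty : tri Φ y r p = t * tri Φ y v r := by
      rw [hst, tri_add_right, tri_smul_right, tri_smul_right, tri_self_outer, hyr,
        tri_comm_right y r v]
      ring
    obtain ⟨d, hd⟩ : ∃ d, pol Φ r p = d := ⟨_, rfl⟩
    -- The conic would split into `ry` and a line through `p`; this vector is where the two
    -- components meet.
    refine hp.pol_ne_zero (d • y + (-(t * tri Φ y v r)) • r) ?_ ?_ ?_ ?_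
    · intro h
      rw [k.add_mem_iff_right (k.smul_mem _ hy), k.smul_mem_iff] at h
      · exact hrk h
      · exact neg_ne_zero.2 (mul_ne_zero ht hb)
    · rw [pol_add_right, pol_smul_right, pol_smul_right, hpr2, hk.pol_eq p hp.mem y hy]; ring
    · simp only [cub_add, cub_smul, pol_smul_left, pol_smul_right, hcy, hcr, hyr, hry]; ring
    · simp only [pol_add_left, pol_smul_left, tri_smul_left, tri_smul_mid, hyp, hty, hd]; ring

end Trilinear

namespace Trilinear

variable {K V : Type*} [Field K] [AddCommGroup V] [Module K V]
  {Φ : V →ₗ[K] V →ₗ[K] V →ₗ[K] K} {B : V → Prop} {k : Submodule K V}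

/-! ### Transversals of a pair of skew lines -/

/-- Only the square contributes in degree 4, because the linear factor multiplies something at most
quadratic. The leading coefficient is therefore `a x₂²`. -/
theorem exists_quartic {a x₂ : K} (ha : a ≠ 0) (hx : x₂ ≠ 0) (x₁ x₀ y₂ y₁ y₀ m₁ m₀ r s s' : K) :
    ∃ P : Polynomial K, P ≠ 0 ∧ P.natDegree ≤ 4 ∧ ∀ τ : K, P.eval τ =
      a * (x₂ * τ ^ 2 + x₁ * τ + x₀) ^ 2 + (m₁ * τ + m₀) *
        ((x₂ * τ ^ 2 + x₁ * τ + x₀) * r + (y₂ * τ ^ 2 + y₁ * τ + y₀) * s + (m₁ * τ + m₀) * s') := by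
  obtain ⟨c₃, hc₃⟩ : ∃ c, c = a * (2 * x₂ * x₁) + m₁ * (x₂ * r + y₂ * s) := ⟨_, rfl⟩
  obtain ⟨c₂, hc₂⟩ : ∃ c, c = a * (x₁ ^ 2 + 2 * x₂ * x₀) + m₀ * (x₂ * r + y₂ * s) +
      m₁ * (x₁ * r + y₁ * s + m₁ * s') := ⟨_, rfl⟩
  obtain ⟨c₁, hc₁⟩ : ∃ c, c = a * (2 * x₁ * x₀) + m₀ * (x₁ * r + y₁ * s + m₁ * s') +
      m₁ * (x₀ * r + y₀ * s + m₀ * s') := ⟨_, rfl⟩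
  obtain ⟨c₀, hc₀⟩ : ∃ c, c = a * x₀ ^ 2 + m₀ * (x₀ * r + y₀ * s + m₀ * s') := ⟨_, rfl⟩
  have hdeg : (Polynomial.C (a * x₂ ^ 2) * Polynomial.X ^ 4 + Polynomial.C c₃ * Polynomial.X ^ 3 +
      Polynomial.C c₂ * Polynomial.X ^ 2 + Polynomial.C c₁ * Polynomial.X +
      Polynomial.C c₀).natDegree = 4 := by
    compute_degree!
  refine ⟨_, fun h => ?_, hdeg.le, fun τ => ?_⟩
  · rw [h] at hdeg; simp at hdeg
  · simp only [Polynomial.eval_add, Polynomial.eval_mul, Polynomial.eval_C, Polynomial.eval_pow,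
      Polynomial.eval_X, hc₀, hc₁, hc₂, hc₃]
    ring

/-- A second line through `r` would lie in the tangent plane at `r` and be a component of the
residual conic. -/
theorem Good.notMem_of_lineOn (hk : LineOn Φ k) {r : V} (hr : Good Φ k r) {l : Submodule K V}
    (hl : LineOn Φ l) (hne : k ≠ l) : r ∉ l := fun hrl => by
  have hfl : FiniteDimensional K l :=
    FiniteDimensional.of_finrank_pos (by rw [hl.finrank_eq]; norm_num)
  have hfk : FiniteDimensional K k :=
    FiniteDimensional.of_finrank_pos (by rw [hk.finrank_eq]; norm_num)
  have hnle : ¬ l ≤ k := fun h =>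
    hne (Submodule.eq_of_le_of_finrank_eq h (by rw [hk.finrank_eq, hl.finrank_eq])).symm
  obtain ⟨v, hv, hvk⟩ := Set.not_subset.1 hnle
  exact hr.pol_ne_zero v hvk (hl.pol_eq r hrl v hv) (hl.cub_eq v hv) (hl.pol_eq v hv r hrl)

theorem SecantClosed.of_add (hB : SecantClosed Φ B) {l l' : Submodule K V}
    (hskew : Disjoint l l') (hBl : ∀ x ∈ l, x ≠ 0 → B x) (hBl' : ∀ x ∈ l', x ≠ 0 → B x) {y y' : V}
    (hy : y ∈ l) (hy' : y' ∈ l') (hcub : cub Φ (y + y') = 0)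
    (hpol : pol Φ y y' ≠ 0 ∨ pol Φ y' y ≠ 0) : B (y + y') := by
  have hy0 : y ≠ 0 := by
    rintro rfl; simp [pol_zero_left, pol_zero_right] at hpol
  have hy0' : y' ≠ 0 := by
    rintro rfl; simp [pol_zero_left, pol_zero_right] at hpol
  have h := hB.secant (a := 1) (b := 1) (hBl y hy hy0) (hBl' y' hy' hy0')
  rw [one_smul, one_smul] at h
  refine h (fun h0 => hy0 ?_) hcub hpol
  refine Submodule.disjoint_def.1 hskew y hy ?_
  rw [eq_neg_of_add_eq_zero_left h0]
  exact l'.neg_mem hy'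

/-- The hard case has both feet `A`, `A'` Eckardt. A good point `R` of the transversal need not be
in `B`, but the points of its residual conic can be reached by secants between `l` and `l'`. A line
through `x` in `T_R` meets that conic in two such points, and they give `x`. -/
theorem SecantClosed.transversal (hB : SecantClosed Φ B) (hΦ : Ample Φ)
    (hK : 13 ≤ Cardinal.mk K) {l l' : Submodule K V} (hl : LineOn Φ l) (hl' : LineOn Φ l')
    (hskew : Disjoint l l') (hsup : l ⊔ l' = ⊤) (hBl : ∀ x ∈ l, x ≠ 0 → B x)
    (hBl' : ∀ x ∈ l', x ≠ 0 → B x)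
    {A A' : V} (hA : A ∈ l) (hA' : A' ∈ l') (hA0 : A ≠ 0) (hA0' : A' ≠ 0)
    (hAA' : pol Φ A A' = 0) (hA'A : pol Φ A' A = 0) : B (A + A') := by
  have h4 := hΦ.finrank_eq
  have hS := hΦ.smooth
  have hdis := Submodule.disjoint_def.1 hskew
  have hind : ∀ a b : K, a • A + b • A' = 0 → a = 0 ∧ b = 0 := by
    intro a b h
    have ha : a • A = 0 := hdis _ (l.smul_mem _ hA) <| by
      rw [eq_neg_of_add_eq_zero_left h]
      exact l'.neg_mem (l'.smul_mem _ hA')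
    rw [ha, zero_add] at h
    exact ⟨(smul_eq_zero.1 ha).resolve_right hA0, (smul_eq_zero.1 h).resolve_right hA0'⟩
  have hcA := hl.cub_eq A hA
  have hcA' := hl'.cub_eq A' hA'
  have hn := lineOn_span_pair hind hcA hAA' hA'A hcA'
  obtain ⟨n, hndef⟩ : ∃ n, Submodule.span K {A, A'} = n := ⟨_, rfl⟩
  have hnA : A ∈ n := hndef ▸ Submodule.subset_span (by simp)
  have hnA' : A' ∈ n := hndef ▸ Submodule.subset_span (by simp)
  have hnspan : ∀ z ∈ n, ∃ a b : K, a • A + b • A' = z := fun z hz => by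
    rwa [← hndef, Submodule.mem_span_pair] at hz
  rw [hndef] at hn
  have hnx : A + A' ∈ n := n.add_mem hnA hnA'
  have hx0 : A + A' ≠ 0 := fun h => one_ne_zero (hind 1 1 (by simpa using h)).1
  by_cases hNA : NonEckardt Φ A
  · exact hNA.line_subset hB hn hΦ hnA (hBl A hA hA0) _ hnx hx0
  by_cases hNA' : NonEckardt Φ A'
  · exact hNA'.line_subset hB hn hΦ hnA' (hBl' A' hA' hA0') _ hnx hx0
  have hnl : n ≠ l := fun h => hA0' (hdis A' (h ▸ hnA') hA')
  have hnl' : n ≠ l' := fun h => hA0 (hdis A hA (h ▸ hnA))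
  obtain ⟨x, hx⟩ : ∃ x, x = A + A' := ⟨_, rfl⟩
  rw [← hx] at hnx hx0 ⊢
  obtain ⟨z, hzn, hxz⟩ := exists_mem_ker_notMem h4 hn.finrank_eq (polHom Φ x)
  rw [polHom_apply] at hxz
  have hindx : ∀ a b : K, a • x + b • A = 0 → a = 0 ∧ b = 0 := by
    intro a b h
    have := hind (a + b) a (by rw [← h, hx]; module)
    exact ⟨this.2, by simpa [this.2] using this.1⟩
  have hcz : tri Φ x A z ≠ 0 ∨ pol Φ A z ≠ 0 := by
    by_contra! h
    obtain ⟨y, hy, hyz⟩ := hΦ.exists_pol_ne_zero n hn z hzn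
    obtain ⟨a, b, rfl⟩ := hnspan y hy
    have he : a • A + b • A' = b • x + (a - b) • A := by rw [hx]; module
    apply hyz
    rw [he]
    simp only [pol_add_left, pol_smul_left, tri_smul_left, tri_smul_mid, hxz, h.1, h.2]; ring
  obtain ⟨t, ht, hR⟩ := hΦ.exists_good n hn x hnx A hnA hindx _ _ hcz
  obtain ⟨R, hRdef⟩ : ∃ R, R = t • x + A := ⟨_, rfl⟩
  rw [← hRdef] at hR
  have hRz : pol Φ R z ≠ 0 := by
    rw [hRdef]
    simp only [pol_add_left, pol_smul_left, tri_smul_left, hxz]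
    convert ht using 1; ring
  have hcR := hn.cub_eq R hR.mem
  have hcx := hn.cub_eq x hnx
  obtain ⟨w, hRw, hxw⟩ : ∃ w, pol Φ R w = 0 ∧ pol Φ x w ≠ 0 := by
    by_contra! h
    exact hRz (eq_zero_of_ker_le (φ := polHom Φ R) (ψ := polHom Φ x)
      (hS.polHom_ne_zero hx0 hcx) h hxz)
  have hwn : w ∉ n := fun h => hxw (hn.pol_eq x hnx w h)
  have hRdecomp : R = (t + 1) • A + t • A' := by rw [hRdef, hx]; module
  have ht1 : t + 1 ≠ 0 := fun h => hR.notMem_of_lineOn hn hl' hnl' <| by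
    rw [hRdecomp, h]; simpa using l'.smul_mem _ hA'
  have ht0 : t ≠ 0 := fun h => hR.notMem_of_lineOn hn hl hnl <| by
    rw [hRdecomp, h]; simpa using hA
  obtain ⟨u, hu, v, hv, hw⟩ := Submodule.mem_sup.1 (hsup ▸ Submodule.mem_top : w ∈ l ⊔ l')
  -- Every tangent line at `A` has contact at least three; for the direction `u + A'` this reads
  -- `tri A A' u = 0`, and similarly at `A'`. So `pol (α A + α' A') w` is the diagonal form `a α² +
  -- a' α'²`.
  have hTu : tri Φ A A' u = 0 := by
    by_contra hT
    refine hNA ⟨u + A', ?_, ?_⟩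
    · rw [pol_add_right, hl.pol_eq A hA u hu, hAA', zero_add]
    · rwa [pol_add_left, hl.pol_eq u hu A hA, hA'A, zero_add, zero_add, tri_comm_right,
        tri_comm_left, tri_comm_right]
  have hTv : tri Φ A A' v = 0 := by
    by_contra hT
    refine hNA' ⟨v + A, ?_, ?_⟩
    · rw [pol_add_right, hl'.pol_eq A' hA' v hv, hA'A, zero_add]
    · rwa [pol_add_left, hl'.pol_eq v hv A' hA', hAA', zero_add, zero_add, tri_comm_left,
        tri_comm_right]
  obtain ⟨a, ha⟩ : ∃ a, pol Φ A v = a := ⟨_, rfl⟩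
  obtain ⟨a', ha'⟩ : ∃ a, pol Φ A' u = a := ⟨_, rfl⟩
  have hAw : pol Φ A w = a := by rw [← hw, pol_add_right, hl.pol_eq A hA u hu, ha, zero_add]
  have hA'w : pol Φ A' w = a' := by rw [← hw, pol_add_right, hl'.pol_eq A' hA' v hv, ha', add_zero]
  have hTw : tri Φ A A' w = 0 := by rw [← hw, tri_add_right, hTu, hTv, add_zero]
  have hTw' : tri Φ A' A w = 0 := by rw [tri_comm_left, hTw]
  have hrel : (t + 1) ^ 2 * a + t ^ 2 * a' = 0 := by
    rw [← hRw, hRdecomp]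
    simp only [pol_add_left, pol_smul_left, tri_smul_left, tri_smul_mid, hAw, hA'w, hTw]; ring
  have hxw' : pol Φ x w = a + a' := by rw [hx, pol_add_left, hAw, hA'w, hTw, add_zero]
  have hsum : a + a' ≠ 0 := hxw' ▸ hxw
  have ha0' : a' ≠ 0 := by
    rintro rfl
    have : a = 0 := by simpa [ht1] using hrel
    exact hsum (by rw [this, add_zero])
  have ha0 : a ≠ 0 := by
    rintro rfl
    exact ha0' (by simpa [ht0] using hrel)
  obtain ⟨b, hb⟩ : ∃ b, tri Φ R x w = b := ⟨_, rfl⟩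
  obtain ⟨c, hc⟩ : ∃ c, pol Φ x w = c := ⟨_, rfl⟩
  obtain ⟨d, hd⟩ : ∃ d, pol Φ w R = d := ⟨_, rfl⟩
  obtain ⟨e, he⟩ : ∃ e, pol Φ w x = e := ⟨_, rfl⟩
  obtain ⟨g, hg⟩ : ∃ g, cub Φ w = g := ⟨_, rfl⟩
  have hbval : b = 2 * (t + 1) * a + 2 * t * a' := by
    rw [← hb, hRdecomp, hx]
    simp only [tri_add_left, tri_add_mid, tri_smul_left, tri_self_left, hAw, hA'w, hTw, hTw']
    ring
  have hcval : c = a + a' := by rw [← hc, hxw']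
  have hc0 : c ≠ 0 := hcval ▸ hsum
  -- Leading coefficient in `τ` of the `A`-coordinate of the conic point `q` below.
  have hlead : b - (t + 1) * c ≠ 0 := by
    intro h
    apply ha0'
    rw [hbval, hcval] at h
    linear_combination (-(t + 1)) * h + hrel
  -- If both vanished, every tangent line at `R` would have contact at least three.
  have hbd : b ≠ 0 ∨ d ≠ 0 := by
    by_contra! h
    obtain ⟨y, hRy, hyR⟩ := hR.nonEckardt
    obtain ⟨y', hy', s, rfl⟩ := exists_eq_add_smul_of_mem_ker h4 hn.finrank_eq
      (hS.polHom_ne_zero hR.ne_zero hcR) (fun z hz => hn.pol_eq R hR.mem z hz) hwn hRw hRy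
    obtain ⟨r, r', rfl⟩ := hnspan y' hy'
    have he : r • A + r' • A' = (r - r') • R + (r' - (r - r') * t) • x := by
      rw [hRdecomp, hx]; module
    apply hyR
    have h1 : tri Φ x w R = b := by rw [tri_comm_right, tri_comm_left, hb]
    rw [pol_add_left, hn.pol_eq _ hy' _ hR.mem, pol_smul_left, tri_smul_mid, he]
    simp only [tri_add_left, tri_smul_left, tri_self_outer, hRw, h1, h.1, hd, h.2]
    ring
  -- The displayed factor is `pol y y'` divided by `m`, for the components `y`, `y'` in `l` and
  -- `l'`. The mixed term in `X Y` is absent because `tri A A' u = 0`.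
  have hcomp : ∀ X Y m : K, cub Φ ((X • A + m • u) + (Y • A' + m • v)) = 0 → m ≠ 0 →
      a * X ^ 2 + m * (X * tri Φ A u v + Y * pol Φ u A' + m * pol Φ u v) ≠ 0 →
      B ((X • A + m • u) + (Y • A' + m • v)) := by
    intro X Y m hcub hm hne
    refine hB.of_add hskew hBl hBl' (l.add_mem (l.smul_mem _ hA) (l.smul_mem _ hu))
      (l'.add_mem (l'.smul_mem _ hA') (l'.smul_mem _ hv)) hcub (Or.inl ?_)
    have h1 : tri Φ A u A' = 0 := by rw [tri_comm_right, hTu]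
    convert mul_ne_zero hm hne using 1
    simp only [pol_add_left, pol_add_right, pol_smul_left, pol_smul_right, tri_smul_left,
      tri_smul_mid, hAA', h1, ha]
    ring
  -- `P₁` vanishes when the secant criterion fails for `q`, and `P₂` when it fails for the third
  -- point of the line `xq`. With the factor `b τ + d` the total degree is at most 9.
  obtain ⟨P₁, hP₁, hdeg₁, heval₁⟩ := exists_quartic ha0 hlead (d - (t + 1) * e) (-(t + 1) * g)
    (b - t * c) (d - t * e) (-t * g) b d (tri Φ A u v) (pol Φ u A') (pol Φ u v)
  obtain ⟨P₂, hP₂, hdeg₂, heval₂⟩ := exists_quartic ha0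
    (mul_ne_zero ht1 (pow_ne_zero 2 hc0)) (((t + 1) * c - b) * e + c * d + e * b)
    (((t + 1) * c - b) * g + e * d) (t * c ^ 2) ((t * c - b) * e + c * d + e * b)
    ((t * c - b) * g + e * d) (-c * b) (-c * d) (tri Φ A u v) (pol Φ u A') (pol Φ u v)
  have hM : (Polynomial.C b * Polynomial.X + Polynomial.C d : Polynomial K) ≠ 0 := by
    intro h
    have h0 := congrArg (Polynomial.coeff · 0) h
    have h1 := congrArg (Polynomial.coeff · 1) h
    simp [Polynomial.coeff_C] at h0 h1
    exact hbd.elim (fun h => h h1) fun h => h h0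
  obtain ⟨τ, hτ⟩ := Polynomial.exists_eval_ne_zero_of_natDegree_lt_card
    ((Polynomial.C b * Polynomial.X + Polynomial.C d) * (P₁ * P₂))
    (mul_ne_zero hM (mul_ne_zero hP₁ hP₂)) <| by
      refine lt_of_lt_of_le (b := 13) ?_ hK
      have h1 : (Polynomial.C b * Polynomial.X + Polynomial.C d : Polynomial K).natDegree ≤ 1 := by
        compute_degree
      have : ((Polynomial.C b * Polynomial.X + Polynomial.C d) * (P₁ * P₂)).natDegree < 13 :=
        lt_of_le_of_lt (Polynomial.natDegree_mul_le_of_le h1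
          (Polynomial.natDegree_mul_le_of_le hdeg₁ hdeg₂)) (by norm_num)
      exact_mod_cast this
  rw [Polynomial.eval_mul, Polynomial.eval_mul, heval₁, heval₂, mul_ne_zero_iff,
    mul_ne_zero_iff] at hτ
  obtain ⟨hM0, h1, h2⟩ := hτ
  simp only [Polynomial.eval_add, Polynomial.eval_mul, Polynomial.eval_C,
    Polynomial.eval_X] at hM0
  obtain ⟨m, hm⟩ : ∃ m, m = b * τ + d := ⟨_, rfl⟩
  obtain ⟨N, hN⟩ : ∃ N, N = c * τ ^ 2 + e * τ + g := ⟨_, rfl⟩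
  rw [← hm] at hM0
  -- Parametrization of the residual conic by projection from `R`: `m = pol (τ x + w) R` and `N =
  -- cub (τ x + w)`.
  obtain ⟨q, hq⟩ : ∃ q, q = (-N) • R + ((τ * m) • x + m • w) := ⟨_, rfl⟩
  have hRx := hn.pol_eq R hR.mem x hnx
  have hxR := hn.pol_eq x hnx R hR.mem
  have hb' : tri Φ x w R = b := by rw [tri_comm_right, tri_comm_left, hb]
  have hcq : cub Φ q = 0 := by
    simp only [hq, cub_add, cub_smul, pol_smul_left, pol_smul_right, pol_add_left, pol_add_right,
      tri_smul_left, tri_smul_mid, hcR, hcx, hRx, hxR, hc, hd, he, hg, hRw, hb']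
    rw [hm, hN]; ring
  have hxq : pol Φ x q = m * c := by
    simp only [hq, pol_add_right, pol_smul_right, hxR, hc, pol_self, hcx]; ring
  have hqx : pol Φ q x = m * (b * -N + 2 * c * (τ * m) + e * m) := by
    have h1 : tri Φ R w x = b := by rw [tri_comm_right, hb]
    simp only [hq, pol_add_left, pol_smul_left, tri_add_mid, tri_smul_left, tri_smul_mid, hRx,
      pol_self, hcx, he, tri_self_outer, tri_self_right, pol_smul_right, hxR, hc, h1]
    ring
  have hqdecomp : q = ((-(t + 1) * N + τ * m) • A + m • u) + ((-t * N + τ * m) • A' + m • v) := by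
    rw [hq, hRdecomp, hx, ← hw]; module
  have hBq : B q := by
    rw [hqdecomp]
    refine hcomp _ _ _ (hqdecomp ▸ hcq) hM0 ?_
    convert h1 using 1
    rw [hm, hN]; ring
  refine hB.of_third hx0 hcx (by rw [hxq]; exact mul_ne_zero hM0 hc0) hBq ?_
  have hc3 := cub_third hcx hcq
  have hthird : pol Φ q x • x + (-pol Φ x q) • q = m •
      (((((t + 1) * c - b) * N + c * (τ * m) + e * m) • A + (-c * m) • u) +
      (((t * c - b) * N + c * (τ * m) + e * m) • A' + (-c * m) • v)) := by
    rw [hqx, hxq, hqdecomp, hx]; module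
  rw [hthird] at hc3 ⊢
  rw [cub_smul] at hc3
  refine hB.smul (hcomp _ _ _ ((mul_eq_zero.1 hc3).resolve_left (pow_ne_zero 3 hM0))
    (mul_ne_zero (neg_ne_zero.2 hc0) hM0) ?_) hM0
  convert h2 using 1
  rw [hm, hN]; ring

/-- A non-Eckardt point on one of two skew lines of the surface generates all points. -/
theorem NonEckardt.generates (hB : SecantClosed Φ B) (hΦ : Ample Φ)
    (hK : 13 ≤ Cardinal.mk K) {l l' : Submodule K V} (hl : LineOn Φ l) (hl' : LineOn Φ l')
    (hskew : Disjoint l l') {p : V} (hpl : p ∈ l) (hp : NonEckardt Φ p) (hBp : B p) :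
    ∀ x, x ≠ 0 → cub Φ x = 0 → B x := by
  have h4 := hΦ.finrank_eq
  have : FiniteDimensional K V := FiniteDimensional.of_finrank_pos (by omega)
  have hBl := hp.line_subset hB hl hΦ hpl hBp
  obtain ⟨r, hrl, hBr, hr⟩ := exists_nonEckardt_of_skew hB hl hΦ hl' hskew hBl
  have hBl' := hr.line_subset hB hl' hΦ hrl hBr
  have hsup : l ⊔ l' = ⊤ := by
    apply Submodule.eq_top_of_finrank_eq
    have := Submodule.finrank_sup_add_finrank_inf_eq l l'
    rw [hskew.eq_bot, finrank_bot, hl.finrank_eq, hl'.finrank_eq] at this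
    omega
  intro x hx0 hx
  obtain ⟨y, hy, y', hy', rfl⟩ := Submodule.mem_sup.1 (hsup ▸ Submodule.mem_top : x ∈ l ⊔ l')
  by_cases hy0 : y = 0
  · subst hy0
    rw [zero_add] at hx0 ⊢
    exact hBl' y' hy' hx0
  by_cases hy0' : y' = 0
  · subst hy0'
    rw [add_zero] at hx0 ⊢
    exact hBl y hy hx0
  by_cases h : pol Φ y y' = 0 ∧ pol Φ y' y = 0
  · exact hB.transversal hΦ hK hl hl' hskew hsup hBl hBl' hy hy' hy0 hy0' h.1 h.2
  · exact hB.of_add hskew hBl hBl' hy hy' hx (by tauto)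

end Trilinear

namespace Trilinear

variable {K V : Type*} [Field K] [AddCommGroup V] [Module K V]
  {Φ : V →ₗ[K] V →ₗ[K] V →ₗ[K] K} {k : Submodule K V}

/-! ### The discriminant of the residual conic -/

variable (Φ) in
/-- The half-discriminant of the conic residual to the line through `u` and `v` in the plane
through `u`, `v` and `z`. -/
def disc (u v z : V) : K :=
  4 * pol Φ u z * pol Φ v z * cub Φ z + tri Φ u v z * pol Φ z u * pol Φ z v -
    pol Φ u z * pol Φ z v ^ 2 - pol Φ v z * pol Φ z u ^ 2 - cub Φ z * tri Φ u v z ^ 2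

theorem disc_swap (u v z : V) : disc Φ u v z = disc Φ v u z := by
  simp only [disc, tri_comm_left v u]; ring

theorem disc_smul (c : K) (u v z : V) : disc Φ u v (c • z) = c ^ 5 * disc Φ u v z := by
  simp only [disc, pol_smul_left, pol_smul_right, tri_smul_right, cub_smul]; ring

theorem disc_shear (u v : V) (t : K) (z : V) :
    disc Φ u (t • u + v) z = disc Φ u v z := by
  simp only [disc, pol_add_left, pol_smul_left, pol_add_right, pol_smul_right, tri_add_mid,
    tri_smul_left, tri_smul_mid, tri_self_left]
  ring

/-- Moving `z` along `k` is a unipotent change of coordinates in the plane, so `disc` depends only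
on the plane up to the scaling of degree five in `disc_smul`. -/
theorem LineOn.disc_add (hk : LineOn Φ k) {u v : V} (hu : u ∈ k) (hv : v ∈ k) (s t : K) (z : V) :
    disc Φ u v (z + (s • u + t • v)) = disc Φ u v z := by
  have h1 : tri Φ z u v = tri Φ u v z := by rw [tri_comm_left, tri_comm_right]
  have h2 : tri Φ z v u = tri Φ u v z := by rw [tri_comm_right, h1]
  simp only [disc, cub_add, cub_smul, pol_add_left, pol_smul_left, pol_add_right, pol_smul_right,
    tri_add_mid, tri_add_right, tri_smul_right, tri_smul_left,
    tri_smul_mid, tri_self_outer, tri_self_right, pol_self, hk.cub_eq u hu,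
    hk.cub_eq v hv, hk.pol_eq u hu v hv, hk.pol_eq v hv u hu, h1, h2]
  ring

/-- The hypothesis on `y` makes the plane the tangent plane at `t u + v`. A conic singular there, or
containing a line through that point, has discriminant zero. -/
theorem LineOn.good_of_disc_ne_zero (hk : LineOn Φ k) (h4 : finrank K V = 4) (hS : Smooth Φ)
    {u v y : V} (hu : u ∈ k) (hv : v ∈ k) (hspan : ∀ x ∈ k, ∃ a b : K, x = a • u + b • v)
    (hind : ∀ a b : K, a • u + b • v = 0 → a = 0 ∧ b = 0) (t : K)
    (hy : pol Φ (t • u + v) y = 0) (hdisc : disc Φ u v y ≠ 0) : Good Φ k (t • u + v) := by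
  rw [← disc_shear u v t] at hdisc
  obtain ⟨p, hp⟩ : ∃ p, p = t • u + v := ⟨_, rfl⟩
  have hpk : p ∈ k := hp ▸ k.add_mem (k.smul_mem _ hu) hv
  have hspan' : ∀ x ∈ k, ∃ a b : K, x = a • u + b • p := fun x hx => by
    obtain ⟨a, b, rfl⟩ := hspan x hx
    exact ⟨a - b * t, b, by rw [hp]; module⟩
  have hp0 : p ≠ 0 := fun h => one_ne_zero (hind t 1 (by rw [← h, hp, one_smul])).2
  rw [← hp] at hy hdisc ⊢
  have hyk : y ∉ k := fun h => hdisc <| by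
    rw [disc, hk.pol_eq u hu y h, hk.pol_eq p hpk y h, hk.tri_eq hu hpk h]; ring
  have h1 : tri Φ p y p = 0 := by rw [tri_self_outer, hy, mul_zero]
  have h2 : tri Φ u y p = tri Φ u p y := tri_comm_right _ _ _
  have hpp := hk.pol_eq p hpk p hpk
  have hup := hk.pol_eq u hu p hpk
  have hpu := hk.pol_eq p hpk u hu
  have hcu := hk.cub_eq u hu
  have hcp := hk.cub_eq p hpk
  have hdisc' : tri Φ u p y * pol Φ y u * pol Φ y p - pol Φ u y * pol Φ y p ^ 2 -
      cub Φ y * tri Φ u p y ^ 2 ≠ 0 := by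
    convert hdisc using 1
    rw [disc, hy]; ring
  refine ⟨hpk, hp0, ?_, ?_⟩
  · by_cases hd : pol Φ y p = 0
    · refine ⟨u + y, by rw [pol_add_right, hpu, hy, add_zero], ?_⟩
      rw [pol_add_left, hup, hd, h2, zero_add, zero_add]
      intro hb
      rw [hd, hb] at hdisc'
      simp at hdisc'
    · exact ⟨y, hy, hd⟩
  · intro m hm hpm hcm hmp
    obtain ⟨x, hx, c, rfl⟩ := exists_eq_add_smul_of_mem_ker h4 hk.finrank_eq
      (hS.polHom_ne_zero hp0 hcp) (fun z hz => hk.pol_eq p hpk z hz) hyk hy hpm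
    have hc : c ≠ 0 := by
      rintro rfl
      exact hm (by simpa using hx)
    obtain ⟨r, s, rfl⟩ := hspan' x hx
    -- `e1` and `e2` say that the line from `p` to the zero lies in the conic; eliminating `r`
    -- between them gives the discriminant.
    have e1 : r * tri Φ u p y + c * pol Φ y p = 0 := by
      refine (mul_eq_zero.1 ?_).resolve_left hc
      rw [← hmp]
      simp only [pol_add_left, pol_smul_left, tri_add_left, tri_smul_left, tri_smul_mid, hup, hpp,
        h1, h2, tri_self_right, pol_smul_right, hpu]
      ring
    have e2 : s * (r * tri Φ u p y + c * pol Φ y p) +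
        (r ^ 2 * pol Φ u y + r * c * pol Φ y u + c ^ 2 * cub Φ y) = 0 := by
      refine (mul_eq_zero.1 ?_).resolve_left hc
      rw [← hcm]
      simp only [cub_add, cub_smul, pol_add_left, pol_smul_left, pol_add_right, pol_smul_right,
        tri_smul_left, tri_smul_mid, hup, hpu, hcu, hcp, hy]
      ring
    rw [e1, mul_zero, zero_add] at e2
    by_cases hb : tri Φ u p y = 0
    · have hd : pol Φ y p = 0 := by simpa [hb, hc] using e1
      rw [hb, hd] at hdisc'
      simp at hdisc'
    · apply hdisc'
      have : c ^ 2 * (tri Φ u p y * pol Φ y u * pol Φ y p - pol Φ u y * pol Φ y p ^ 2 -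
          cub Φ y * tri Φ u p y ^ 2) = 0 := by
        linear_combination (-tri Φ u p y ^ 2) * e2 + (pol Φ u y * r * tri Φ u p y
          - pol Φ u y * c * pol Φ y p + tri Φ u p y * c * pol Φ y u) * e1
      exact (mul_eq_zero.1 this).resolve_left (pow_ne_zero 2 hc)

/-! ### Algebraically closed fields -/

theorem exists_root_quadratic [IsAlgClosed K] {a : K} (ha : a ≠ 0) (b c : K) :
    ∃ t : K, a * t ^ 2 + b * t + c = 0 := by
  obtain ⟨t, ht⟩ := IsAlgClosed.exists_root
    (Polynomial.C a * Polynomial.X ^ 2 + Polynomial.C b * Polynomial.X + Polynomial.C c)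
    (by rw [Polynomial.degree_quadratic ha]; norm_num)
  exact ⟨t, by simpa using ht⟩

/-- Used to extract the first-order coefficient of a discriminant that is assumed to vanish
identically. -/
theorem eval_zero_eq_zero_of_forall_mul_eval [Infinite K] {H : Polynomial K}
    (h : ∀ t : K, t * H.eval t = 0) : H.eval 0 = 0 := by
  have : Polynomial.X * H = 0 := Polynomial.funext fun t => by simpa using h t
  rw [(mul_eq_zero.1 this).resolve_left Polynomial.X_ne_zero, Polynomial.eval_zero]

/-- Otherwise one plane would be tangent along all of `k`. For `z` outside it, `pol x z` is
quadratic on `k` and has a zero `x`, where the derivative kills the plane and `z`, contradicting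
smoothness. -/
theorem LineOn.exists_pol_ne_zero [IsAlgClosed K] (h4 : finrank K V = 4) (hS : Smooth Φ)
    (hk : LineOn Φ k) {y : V} (hy : y ∉ k) : ∃ x ∈ k, pol Φ x y ≠ 0 := by
  by_contra! h
  have : FiniteDimensional K V := FiniteDimensional.of_finrank_pos (by omega)
  have hne : ¬ (⊤ : Submodule K V) ≤ k ⊔ K ∙ y := fun hle => by
    have h1 := Submodule.finrank_mono hle
    have h2 := Submodule.finrank_add_le_finrank_add_finrank k (K ∙ y)
    have h3 := finrank_span_le_card (R := K) ({y} : Set V)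
    rw [finrank_top, h4] at h1
    rw [hk.finrank_eq] at h2
    simp at h3
    omega
  obtain ⟨z, -, hz⟩ := Set.not_subset.1 hne
  obtain ⟨x, hx, hx0, hxz⟩ : ∃ x ∈ k, x ≠ 0 ∧ pol Φ x z = 0 := by
    have : Nontrivial k := Module.nontrivial_of_finrank_pos (R := K) (by rw [hk.finrank_eq]; norm_num)
    obtain ⟨⟨u, hu⟩, hu0⟩ := exists_ne (0 : k)
    have hu0 : u ≠ 0 := fun h => hu0 (Subtype.ext h)
    obtain ⟨v, hv, -, hind⟩ := exists_basis_of_finrank_eq_two hk.finrank_eq hu hu0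
    by_cases huz : pol Φ u z = 0
    · exact ⟨u, hu, hu0, huz⟩
    · obtain ⟨t, ht⟩ := exists_root_quadratic huz (tri Φ u v z) (pol Φ v z)
      refine ⟨t • u + v, k.add_mem (k.smul_mem _ hu) hv, fun h => ?_, ?_⟩
      · exact one_ne_zero (hind t 1 (by simpa using h)).2
      · rw [← ht, pol_add_left, pol_smul_left, tri_smul_left]; ring
  obtain ⟨x', hx', c, rfl⟩ := exists_eq_add_smul_of_mem_ker h4 hk.finrank_eq
    (hS.polHom_ne_zero hx0 (hk.cub_eq x hx)) (fun w hw => hk.pol_eq x hx w hw) hy (h x hx) hxz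
  exact hz (Submodule.add_mem_sup hx' (Submodule.smul_mem _ _ (Submodule.mem_span_singleton_self y)))

theorem pair_of_notMem {p u y : V} (hu : u ∈ k) (hp : p ∈ k) (hp0 : p ≠ 0) (hy : y ∉ k)
    (t : K) : ∀ a b : K, a • p + b • (t • u + y) = 0 → a = 0 ∧ b = 0 := by
  intro a b h
  have hb : b = 0 := by
    by_contra hb
    have h1 : b • (t • u + y) ∈ k := by
      rw [eq_neg_of_add_eq_zero_right h]
      exact k.neg_mem (k.smul_mem _ hp)
    rw [k.smul_mem_iff hb, k.add_mem_iff_right (k.smul_mem _ hu)] at h1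
    exact hy h1
  subst hb
  exact ⟨by simpa [hp0] using h, rfl⟩

theorem LineOn.lineOn_of_root (hk : LineOn Φ k) {p u y : V} (hp : p ∈ k) (hp0 : p ≠ 0)
    (hu : u ∈ k) (hy : y ∉ k) (hpy : pol Φ p y = 0) (hpuy : tri Φ p u y = 0) (hyp : pol Φ y p = 0)
    {t : K} (ht : pol Φ u y * t ^ 2 + pol Φ y u * t + cub Φ y = 0) :
    LineOn Φ (Submodule.span K {p, t • u + y}) := by
  refine lineOn_span_pair (pair_of_notMem hu hp hp0 hy t) (hk.cub_eq p hp) ?_ ?_ ?_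
  · rw [pol_add_right, pol_smul_right, hk.pol_eq p hp u hu, hpy]; ring
  · rw [pol_add_left, pol_smul_left, hk.pol_eq u hu p hp, hyp, tri_smul_left, tri_comm_right,
      tri_comm_left, hpuy]
    ring
  · rw [← ht, cub_add, cub_smul, pol_smul_left, pol_smul_right, hk.cub_eq u hu]; ring

/-- Here the residual conic consists of lines through `p` given by the roots of a quadratic. A
double root would be a double line, along which the plane is tangent. -/
theorem LineOn.derivative_root_ne_zero [IsAlgClosed K] (h4 : finrank K V = 4) (hS : Smooth Φ)
    (hk : LineOn Φ k) {p u y : V} (hp : p ∈ k) (hu : u ∈ k)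
    (hind : ∀ a b : K, a • p + b • u = 0 → a = 0 ∧ b = 0) (hy : y ∉ k) (hpy : pol Φ p y = 0)
    (hpuy : tri Φ p u y = 0) (hyp : pol Φ y p = 0) {t : K}
    (ht : pol Φ u y * t ^ 2 + pol Φ y u * t + cub Φ y = 0) :
    2 * pol Φ u y * t + pol Φ y u ≠ 0 := by
  intro h
  have hp0 : p ≠ 0 := fun h => one_ne_zero (hind 1 0 (by simp [h])).1
  have hl := hk.lineOn_of_root hp hp0 hu hy hpy hpuy hyp ht
  have hul : u ∉ Submodule.span K {p, t • u + y} := fun hm => by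
    obtain ⟨a, b, hab⟩ := Submodule.mem_span_pair.1 hm
    by_cases hb : b = 0
    · subst hb
      exact one_ne_zero (neg_eq_zero.1 (hind a (-1) (by rw [← hab]; module)).2)
    · refine hy ?_
      have h1 : b • (t • u + y) ∈ k := by
        rw [eq_sub_of_add_eq' hab]
        exact k.sub_mem hu (k.smul_mem _ hp)
      rwa [k.smul_mem_iff hb, k.add_mem_iff_right (k.smul_mem _ hu)] at h1
  obtain ⟨x, hx, hxu⟩ := hl.exists_pol_ne_zero h4 hS hul
  obtain ⟨a, b, rfl⟩ := Submodule.mem_span_pair.1 hx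
  apply hxu
  have h1 : tri Φ p y u = 0 := by rw [tri_comm_right, hpuy]
  simp only [pol_add_left, pol_smul_left, tri_smul_left, tri_smul_mid, tri_add_mid,
    tri_self_outer, tri_self_right, pol_smul_right, hk.pol_eq p hp u hu, hk.pol_eq u hu u hu,
    hk.pol_eq u hu p hp, h1]
  linear_combination b ^ 2 * h

/-- If the conic at `t = 0` is singular, the discriminant has a simple zero there. The first-order
coefficient is computed at a singular point of the conic, on `k` (`b = 0`) or off it, and vanishing
would contradict smoothness. -/
theorem LineOn.exists_disc_ne_zero [IsAlgClosed K] (h4 : finrank K V = 4) (hS : Smooth Φ)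
    (hk : LineOn Φ k) {u v : V} (hu : u ∈ k) (hv : v ∈ k)
    (hspan : ∀ x ∈ k, ∃ a b : K, x = a • u + b • v)
    (hind : ∀ a b : K, a • u + b • v = 0 → a = 0 ∧ b = 0) {z₀ z₁ : V} (huz₀ : pol Φ u z₀ ≠ 0)
    (huz₁ : pol Φ u z₁ = 0) (hz₁ : z₁ ∉ k) : ∃ t : K, disc Φ u v (z₀ + t • z₁) ≠ 0 := by
  by_contra! h
  have hInf : Infinite K := IsAlgClosed.instInfinite
  obtain ⟨s, hs⟩ := exists_root_quadratic huz₀ (tri Φ u v z₀) (pol Φ v z₀)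
  obtain ⟨p, hp⟩ : ∃ p, p = s • u + v := ⟨_, rfl⟩
  have hpk : p ∈ k := hp ▸ k.add_mem (k.smul_mem _ hu) hv
  have hpz₀ : pol Φ p z₀ = 0 := by
    rw [← hs, hp, pol_add_left, pol_smul_left, tri_smul_left]; ring
  have hind' : ∀ a b : K, a • p + b • u = 0 → a = 0 ∧ b = 0 := by
    intro a b hab
    have h1 := hind (a * s + b) a (by rw [← hab, hp]; module)
    exact ⟨h1.2, by simpa [h1.2] using h1.1⟩
  have hspan' : ∀ x ∈ k, ∃ a b : K, x = a • p + b • u := fun x hx => by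
    obtain ⟨a, b, rfl⟩ := hspan x hx
    exact ⟨b, a - b * s, by rw [hp]; module⟩
  have hp0 : p ≠ 0 := fun h => one_ne_zero (hind' 1 0 (by simp [h])).1
  have hD : ∀ t : K, disc Φ p u (z₀ + t • z₁) = 0 := fun t => by
    rw [disc_swap, hp, disc_shear, h]
  have hz₀ : z₀ ∉ k := fun hz => huz₀ (hk.pol_eq u hu z₀ hz)
  -- A tangent plane containing `k` and `z₀` is the plane they span, and `z₁` is not in it.
  have hne : ∀ m : V, m ≠ 0 → cub Φ m = 0 → (∀ x ∈ k, pol Φ m x = 0) → pol Φ m z₀ = 0 →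
      pol Φ m z₁ ≠ 0 := by
    intro m hm0 hm hmk hmz₀ hmz₁
    obtain ⟨x, hx, c, rfl⟩ := exists_eq_add_smul_of_mem_ker h4 hk.finrank_eq
      (hS.polHom_ne_zero hm0 hm) hmk hz₀ hmz₀ hmz₁
    rw [pol_add_right, pol_smul_right, hk.pol_eq u hu x hx, zero_add, mul_eq_zero] at huz₁
    exact hz₁ (by simpa [huz₁.resolve_right huz₀] using hx)
  obtain ⟨a, ha⟩ : ∃ a, pol Φ p z₁ = a := ⟨_, rfl⟩
  obtain ⟨b, hb⟩ : ∃ b, tri Φ p u z₀ = b := ⟨_, rfl⟩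
  obtain ⟨c, hc⟩ : ∃ c, pol Φ u z₀ = c := ⟨_, rfl⟩
  obtain ⟨d, hd⟩ : ∃ d, pol Φ z₀ p = d := ⟨_, rfl⟩
  obtain ⟨e, he⟩ : ∃ e, pol Φ z₀ u = e := ⟨_, rfl⟩
  obtain ⟨g, hg⟩ : ∃ g, cub Φ z₀ = g := ⟨_, rfl⟩
  obtain ⟨b₁, hb₁⟩ : ∃ b, tri Φ p u z₁ = b := ⟨_, rfl⟩
  obtain ⟨d₂, hd₂⟩ : ∃ d, pol Φ z₁ p = d := ⟨_, rfl⟩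
  obtain ⟨e₂, he₂⟩ : ∃ e, pol Φ z₁ u = e := ⟨_, rfl⟩
  obtain ⟨g₃, hg₃⟩ : ∃ g, cub Φ z₁ = g := ⟨_, rfl⟩
  have hc0 : c ≠ 0 := hc ▸ huz₀
  have ha0 : a ≠ 0 := ha ▸ hne p hp0 (hk.cub_eq p hpk) (fun x hx => hk.pol_eq p hpk x hx) hpz₀
  have h0 : b * d * e - c * d ^ 2 - g * b ^ 2 = 0 := by
    have := hD 0
    rw [zero_smul, add_zero, disc, hpz₀, hb, hc, hd, he, hg] at this
    linear_combination this
  by_cases hb0 : b = 0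
  · have hd0 : d = 0 := by simpa [hb0, hc0] using h0
    rw [hb0] at hb
    rw [hd0] at hd
    obtain ⟨d₁, hd₁⟩ : ∃ d, tri Φ z₀ z₁ p = d := ⟨_, rfl⟩
    obtain ⟨e₁, he₁⟩ : ∃ e, tri Φ z₀ z₁ u = e := ⟨_, rfl⟩
    obtain ⟨g₁, hg₁⟩ : ∃ g, pol Φ z₀ z₁ = g := ⟨_, rfl⟩
    obtain ⟨g₂, hg₂⟩ : ∃ g, pol Φ z₁ z₀ = g := ⟨_, rfl⟩
    obtain ⟨E, hE⟩ : ∃ E : Polynomial K, E = Polynomial.C e + Polynomial.X * Polynomial.C e₁ +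
      Polynomial.X ^ 2 * Polynomial.C e₂ := ⟨_, rfl⟩
    obtain ⟨G, hG⟩ : ∃ G : Polynomial K, G = Polynomial.C g + Polynomial.X * Polynomial.C g₁ +
      Polynomial.X ^ 2 * Polynomial.C g₂ + Polynomial.X ^ 3 * Polynomial.C g₃ := ⟨_, rfl⟩
    have key := eval_zero_eq_zero_of_forall_mul_eval (H := Polynomial.C (4 * a * c) * G +
      Polynomial.X * Polynomial.C b₁ * (Polynomial.C d₁ + Polynomial.X * Polynomial.C d₂) * E -
      Polynomial.C a * E ^ 2 -
      Polynomial.C c * Polynomial.X * (Polynomial.C d₁ + Polynomial.X * Polynomial.C d₂) ^ 2 -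
      G * Polynomial.X * Polynomial.C b₁ ^ 2) fun t => by
        rw [← hD t]
        simp only [disc, pol_add_left, pol_smul_left, pol_add_right, pol_smul_right, cub_add,
          cub_smul, tri_add_right, tri_smul_right, tri_smul_mid, hpz₀, ha, hb, hc, huz₁, hd, he,
          hg, hb₁, hd₂, he₂, hg₃, hd₁, he₁, hg₁, hg₂, hE, hG, Polynomial.eval_add,
          Polynomial.eval_sub, Polynomial.eval_mul, Polynomial.eval_pow, Polynomial.eval_C,
          Polynomial.eval_X]
        ring
    simp only [hE, hG, Polynomial.eval_add, Polynomial.eval_sub, Polynomial.eval_mul,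
      Polynomial.eval_pow, Polynomial.eval_C, Polynomial.eval_X] at key
    -- The conic is singular at `p`, hence a pair of lines through `p`; the first-order term says
    -- that they coincide.
    have key' : 4 * c * g - e ^ 2 = 0 := by
      refine (mul_eq_zero.1 ?_).resolve_left ha0
      linear_combination key
    obtain ⟨r, hr⟩ := exists_root_quadratic hc0 e g
    refine hk.derivative_root_ne_zero h4 hS hpk hu hind' hz₀ hpz₀ hb hd (t := r)
      (by rw [hc, he, hg, hr]) ?_
    rw [hc, he]
    refine pow_eq_zero_iff two_ne_zero |>.1 ?_
    linear_combination 4 * c * hr - key'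
  -- `x` and `y` are the coordinates of the singular point `m` of the conic, here off `k`.
  · obtain ⟨x, hx⟩ : ∃ x, b * x + d = 0 := ⟨-d / b, by field_simp; ring⟩
    obtain ⟨y, hy⟩ : ∃ y, b * y + (e + 2 * x * c) = 0 :=
      ⟨-(e + 2 * x * c) / b, by field_simp; ring⟩
    obtain ⟨m, hm⟩ : ∃ m, m = z₀ + (y • p + x • u) := ⟨_, rfl⟩
    have hyxk : y • p + x • u ∈ k := k.add_mem (k.smul_mem _ hpk) (k.smul_mem _ hu)
    have hmk : m ∉ k := by rwa [hm, k.add_mem_iff_left hyxk]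
    have hcp := hk.cub_eq p hpk
    have hcu := hk.cub_eq u hu
    have hpu := hk.pol_eq p hpk u hu
    have hup := hk.pol_eq u hu p hpk
    have t1 : tri Φ z₀ p u = b := by rw [tri_comm_left, tri_comm_right, hb]
    have t2 : tri Φ z₀ u p = b := by rw [tri_comm_right, t1]
    have hmp : pol Φ m p = 0 := by
      simp only [hm, pol_add_left, pol_smul_left, tri_add_mid, tri_smul_mid, tri_smul_left,
        pol_self, hcp, hup, hd, tri_self_right, tri_self_outer, hpu, hpz₀, t2]
      linear_combination hx
    have hmu : pol Φ m u = 0 := by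
      simp only [hm, pol_add_left, pol_smul_left, tri_add_mid, tri_smul_mid,
        pol_self, pol_smul_right, hcu, hup, he, tri_self_right, hpu, hc, t1]
      linear_combination hy
    have hcm : cub Φ m = 0 := by
      refine (mul_eq_zero.1 ?_).resolve_left (pow_ne_zero 2 hb0)
      simp only [hm, cub_add, cub_smul, pol_add_left, pol_add_right, pol_smul_left,
        pol_smul_right, tri_smul_left, tri_smul_mid, hcp, hcu, hpu, hup, hpz₀, hc, hd, he, hg, hb]
      linear_combination (b ^ 2 * y + b * e + c * (b * x - d)) * hx - h0
    have hpm : pol Φ p m = 0 := by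
      rw [hm, pol_add_right, hpz₀, hk.pol_eq p hpk _ hyxk, add_zero]
    have hum : pol Φ u m = c := by
      rw [hm, pol_add_right, hc, hk.pol_eq u hu _ hyxk, add_zero]
    have htm : tri Φ p u m = b := by
      rw [hm, tri_add_right, hb, hk.tri_eq hpk hu hyxk, add_zero]
    have hmm : pol Φ m m = 0 := by rw [pol_self, hcm, mul_zero]
    have hmk' : ∀ w ∈ k, pol Φ m w = 0 := fun w hw => by
      obtain ⟨r, r', rfl⟩ := hspan' w hw
      rw [pol_add_right, pol_smul_right, pol_smul_right, hmp, hmu]; ring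
    have hmz₀ : pol Φ m z₀ = 0 := by
      have h1 := pol_add_right (Φ := Φ) m z₀ (y • p + x • u)
      rw [← hm, hmm, hmk' _ hyxk] at h1
      simpa using h1.symm
    have hg0 := hne m (fun h => hmk (h ▸ k.zero_mem)) hcm hmk' hmz₀
    have hD' : ∀ t : K, disc Φ p u (m + t • z₁) = 0 := fun t => by
      rw [← hD t, ← hk.disc_add hpk hu y x (z₀ + t • z₁), hm]
      congr 1; abel
    obtain ⟨d₁, hd₁⟩ : ∃ d, tri Φ m z₁ p = d := ⟨_, rfl⟩
    obtain ⟨e₁, he₁⟩ : ∃ e, tri Φ m z₁ u = e := ⟨_, rfl⟩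
    obtain ⟨g₁, hg₁⟩ : ∃ g, pol Φ m z₁ = g := ⟨_, rfl⟩
    obtain ⟨g₂, hg₂⟩ : ∃ g, pol Φ z₁ m = g := ⟨_, rfl⟩
    obtain ⟨D, hDdef⟩ : ∃ D : Polynomial K,
      D = Polynomial.C d₁ + Polynomial.X * Polynomial.C d₂ := ⟨_, rfl⟩
    obtain ⟨E, hE⟩ : ∃ E : Polynomial K,
      E = Polynomial.C e₁ + Polynomial.X * Polynomial.C e₂ := ⟨_, rfl⟩
    obtain ⟨G, hG⟩ : ∃ G : Polynomial K, G = Polynomial.C g₁ + Polynomial.X * Polynomial.C g₂ +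
      Polynomial.X ^ 2 * Polynomial.C g₃ := ⟨_, rfl⟩
    obtain ⟨T, hT⟩ : ∃ T : Polynomial K,
      T = Polynomial.C b + Polynomial.X * Polynomial.C b₁ := ⟨_, rfl⟩
    have key := eval_zero_eq_zero_of_forall_mul_eval
      (H := Polynomial.C (4 * a * c) * Polynomial.X * G + T * Polynomial.X * D * E -
        Polynomial.C a * Polynomial.X ^ 2 * E ^ 2 - Polynomial.C c * Polynomial.X * D ^ 2 -
        G * T ^ 2) fun t => by
        rw [← hD' t]
        simp only [disc, pol_add_left, pol_smul_left, pol_add_right, pol_smul_right, cub_add,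
          cub_smul, tri_add_right, tri_smul_right, tri_smul_mid, hpm, ha, htm, hum, huz₁, hmp, hmu,
          hcm, hb₁, hd₂, he₂, hg₃, hd₁, he₁, hg₁, hg₂, hDdef, hE, hG, hT, Polynomial.eval_add,
          Polynomial.eval_sub, Polynomial.eval_mul, Polynomial.eval_pow, Polynomial.eval_C,
          Polynomial.eval_X]
        ring
    simp only [hE, hG, hT, hDdef, Polynomial.eval_add, Polynomial.eval_sub, Polynomial.eval_mul,
      Polynomial.eval_pow, Polynomial.eval_C, Polynomial.eval_X] at key
    -- The first-order coefficient is `-g₁ b²` with `g₁ = pol m z₁`.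
    have : g₁ * b ^ 2 = 0 := by linear_combination -key
    exact (mul_eq_zero.1 this).elim (hg₁ ▸ hg0) (pow_ne_zero 2 hb0)

/-- The vector inside `disc` lies in the tangent plane at `t u + v` and is quadratic in `t`, whence
degree `2 · 5`. Every plane `z₀ + s z₁` of the pencil is tangent at some point of `k`, so a plane
with nonzero discriminant shows that the polynomial is nonzero. -/
theorem LineOn.exists_disc_polynomial [IsAlgClosed K] (h4 : finrank K V = 4) (hS : Smooth Φ)
    (hk : LineOn Φ k) {u v : V} (hu : u ∈ k) (hv : v ∈ k)
    (hspan : ∀ x ∈ k, ∃ a b : K, x = a • u + b • v)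
    (hind : ∀ a b : K, a • u + b • v = 0 → a = 0 ∧ b = 0) {z₀ z₁ : V} (huz₀ : pol Φ u z₀ ≠ 0)
    (huz₁ : pol Φ u z₁ = 0) (hz₁ : z₁ ∉ k) :
    ∃ G : Polynomial K, G ≠ 0 ∧ G.natDegree ≤ 10 ∧ ∀ t : K, G.eval t = disc Φ u v
      (pol Φ (t • u + v) z₁ • z₀ + (-pol Φ (t • u + v) z₀) • z₁) := by
  obtain ⟨A, hA⟩ : ∃ A : Polynomial K, A = Polynomial.C (pol Φ u z₁) * Polynomial.X ^ 2 +
    Polynomial.C (tri Φ u v z₁) * Polynomial.X + Polynomial.C (pol Φ v z₁) := ⟨_, rfl⟩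
  obtain ⟨B, hB⟩ : ∃ A : Polynomial K, A = -(Polynomial.C (pol Φ u z₀) * Polynomial.X ^ 2 +
    Polynomial.C (tri Φ u v z₀) * Polynomial.X + Polynomial.C (pol Φ v z₀)) := ⟨_, rfl⟩
  have hAdeg : A.natDegree ≤ 2 := by rw [hA]; compute_degree
  have hBdeg : B.natDegree ≤ 2 := by rw [hB]; compute_degree
  have hpow : ∀ {F : Polynomial K} {n : ℕ} (m : ℕ), F.natDegree ≤ n →
      (F ^ m).natDegree ≤ m * n := fun m h => Polynomial.natDegree_pow_le_of_le m h
  have hmul : ∀ {F G : Polynomial K} {m n : ℕ}, F.natDegree ≤ m → G.natDegree ≤ n →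
      (F * G).natDegree ≤ m + n := Polynomial.natDegree_mul_le_of_le
  have hadd : ∀ {F G : Polynomial K} {n : ℕ}, F.natDegree ≤ n → G.natDegree ≤ n →
      (F + G).natDegree ≤ n := Polynomial.natDegree_add_le_of_degree_le
  have hsub : ∀ {F G : Polynomial K} {n : ℕ}, F.natDegree ≤ n → G.natDegree ≤ n →
      (F - G).natDegree ≤ n := fun hF hG => Polynomial.natDegree_sub_le_of_le hF hG |>.trans (by simp)
  have hC : ∀ a : K, (Polynomial.C a).natDegree ≤ 0 := fun a => (Polynomial.natDegree_C a).le
  have hlin : ∀ a b : K, (A * Polynomial.C a + B * Polynomial.C b).natDegree ≤ 2 := fun a b =>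
    hadd (hmul hAdeg (hC a)) (hmul hBdeg (hC b))
  have hquad : ∀ a b c : K, (A ^ 2 * Polynomial.C a + A * B * Polynomial.C b +
      B ^ 2 * Polynomial.C c).natDegree ≤ 4 := fun a b c =>
    hadd (hadd (hmul (hpow 2 hAdeg) (hC a)) (hmul (hmul hAdeg hBdeg) (hC b)))
      (hmul (hpow 2 hBdeg) (hC c))
  have hcubic : ∀ a b c d : K, (A ^ 3 * Polynomial.C a + A ^ 2 * B * Polynomial.C b +
      A * B ^ 2 * Polynomial.C c + B ^ 3 * Polynomial.C d).natDegree ≤ 6 := fun a b c d =>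
    hadd (hadd (hadd (hmul (hpow 3 hAdeg) (hC a)) (hmul (hmul (hpow 2 hAdeg) hBdeg) (hC b)))
      (hmul (hmul hAdeg (hpow 2 hBdeg)) (hC c))) (hmul (hpow 3 hBdeg) (hC d))
  have ha := hlin (pol Φ u z₀) (pol Φ u z₁)
  have hb := hlin (tri Φ u v z₀) (tri Φ u v z₁)
  have hc := hlin (pol Φ v z₀) (pol Φ v z₁)
  have hd := hquad (pol Φ z₀ u) (tri Φ z₀ z₁ u) (pol Φ z₁ u)
  have he := hquad (pol Φ z₀ v) (tri Φ z₀ z₁ v) (pol Φ z₁ v)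
  have hg := hcubic (cub Φ z₀) (pol Φ z₀ z₁) (pol Φ z₁ z₀) (cub Φ z₁)
  have hmul' : ∀ {F G : Polynomial K} {m n : ℕ}, F.natDegree ≤ m → G.natDegree ≤ n →
      m + n ≤ 10 → (F * G).natDegree ≤ 10 := fun hF hG h => (hmul hF hG).trans h
  have hdeg := hsub (hsub (hsub (hadd (hmul' (hmul (hmul (hC 4) ha) hc) hg (by norm_num))
    (hmul' (hmul hb hd) he (by norm_num))) (hmul' ha (hpow 2 he) (by norm_num)))
    (hmul' hc (hpow 2 hd) (by norm_num))) (hmul' hg (hpow 2 hb) (by norm_num))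
  have hevalA : ∀ t : K, A.eval t = pol Φ (t • u + v) z₁ := fun t => by
    simp only [hA, pol_add_left, pol_smul_left, tri_smul_left, Polynomial.eval_add,
      Polynomial.eval_mul, Polynomial.eval_pow, Polynomial.eval_C, Polynomial.eval_X]
    ring
  have hevalB : ∀ t : K, B.eval t = -pol Φ (t • u + v) z₀ := fun t => by
    simp only [hB, pol_add_left, pol_smul_left, tri_smul_left, Polynomial.eval_add,
      Polynomial.eval_neg, Polynomial.eval_mul, Polynomial.eval_pow, Polynomial.eval_C,
      Polynomial.eval_X]
    ring
  obtain ⟨G, hGdeg, heval⟩ : ∃ G : Polynomial K, G.natDegree ≤ 10 ∧ ∀ t : K, G.eval t = disc Φ u v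
      (pol Φ (t • u + v) z₁ • z₀ + (-pol Φ (t • u + v) z₀) • z₁) := by
    refine ⟨_, hdeg, fun t => ?_⟩
    rw [← hevalA, ← hevalB]
    simp only [disc, pol_add_left (_ • z₀), pol_smul_left, pol_add_right,
      pol_smul_right, cub_add, cub_smul, tri_add_right, tri_smul_right, tri_smul_mid,
      tri_smul_left, Polynomial.eval_add, Polynomial.eval_sub, Polynomial.eval_mul,
      Polynomial.eval_pow, Polynomial.eval_C]
    ring
  refine ⟨G, fun h0 => ?_, hGdeg, heval⟩
  obtain ⟨s, hs⟩ := hk.exists_disc_ne_zero h4 hS hu hv hspan hind huz₀ huz₁ hz₁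
  have huz : pol Φ u (z₀ + s • z₁) ≠ 0 := by
    rwa [pol_add_right, pol_smul_right, huz₁, mul_zero, add_zero]
  obtain ⟨t, ht⟩ := exists_root_quadratic huz (tri Φ u v (z₀ + s • z₁)) (pol Φ v (z₀ + s • z₁))
  have hp : pol Φ (t • u + v) (z₀ + s • z₁) = 0 := by
    rw [← ht, pol_add_left, pol_smul_left, tri_smul_left]; ring
  obtain ⟨p, hpdef⟩ : ∃ p, p = t • u + v := ⟨_, rfl⟩
  have hev := heval t
  rw [h0, Polynomial.eval_zero, ← hpdef] at hev
  rw [← hpdef] at hp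
  have hpk : p ∈ k := hpdef ▸ k.add_mem (k.smul_mem _ hu) hv
  have hp0 : p ≠ 0 := fun h => one_ne_zero (hind t 1 (by rw [← h, hpdef, one_smul])).2
  have hpz₀ : -pol Φ p z₀ = pol Φ p z₁ * s := by
    rw [pol_add_right, pol_smul_right] at hp
    linear_combination -hp
  have hz : pol Φ p z₁ • z₀ + (-pol Φ p z₀) • z₁ = pol Φ p z₁ • (z₀ + s • z₁) := by
    rw [hpz₀]; module
  rw [hz, disc_smul] at hev
  have hpz₁ : pol Φ p z₁ = 0 := by
    have := (mul_eq_zero.1 hev.symm).resolve_right hs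
    exact (pow_eq_zero_iff (by norm_num)).1 this
  rw [hpz₁, zero_mul, neg_eq_zero] at hpz₀
  obtain ⟨x, hx, c, rfl⟩ := exists_eq_add_smul_of_mem_ker h4 hk.finrank_eq
    (hS.polHom_ne_zero hp0 (hk.cub_eq p hpk)) (fun x hx => hk.pol_eq p hpk x hx) hz₁ hpz₁ hpz₀
  apply huz₀
  rw [pol_add_right, pol_smul_right, hk.pol_eq u hu x hx, huz₁]; ring

end Trilinear

universe w

namespace Trilinear

/-! ### Extension of the base field -/

section Coefficients

variable {K : Type*} [Field K]

/-- The trilinear form on `K ^ 4` with coefficients `a`. -/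
noncomputable def ofCoeff (a : Fin 4 → Fin 4 → Fin 4 → K) :
    (Fin 4 → K) →ₗ[K] (Fin 4 → K) →ₗ[K] (Fin 4 → K) →ₗ[K] K :=
  ∑ i, ∑ j, ∑ k, a i j k • (LinearMap.proj i : (Fin 4 → K) →ₗ[K] K).smulRight
    ((LinearMap.proj j : (Fin 4 → K) →ₗ[K] K).smulRight (LinearMap.proj k))

theorem ofCoeff_apply (a : Fin 4 → Fin 4 → Fin 4 → K) (x y z : Fin 4 → K) :
    ofCoeff a x y z = ∑ i, ∑ j, ∑ k, a i j k * (x i * y j * z k) := by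
  simp only [ofCoeff, LinearMap.sum_apply, LinearMap.smul_apply, LinearMap.smulRight_apply,
    LinearMap.proj_apply, smul_eq_mul, mul_assoc]

/-- The cubic form on `K ^ 4` with coefficients `a`. -/
noncomputable def formOfCoeff (a : Fin 4 → Fin 4 → Fin 4 → K) : MvPolynomial (Fin 4) K :=
  ∑ i, ∑ j, ∑ k, C (a i j k) * (X i * X j * X k)

theorem eval_formOfCoeff (a : Fin 4 → Fin 4 → Fin 4 → K) (x : Fin 4 → K) :
    eval x (formOfCoeff a) = cub (ofCoeff a) x := by
  simp only [formOfCoeff, cub, ofCoeff_apply, map_sum, map_mul, eval_C, eval_X]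

theorem eval_pderiv_formOfCoeff (a : Fin 4 → Fin 4 → Fin 4 → K) (x : Fin 4 → K) (i : Fin 4) :
    eval x (pderiv i (formOfCoeff a)) = pol (ofCoeff a) x (Pi.single i 1) := by
  have h : ∀ j : Fin 4, eval x (Pi.single (M := fun _ => MvPolynomial (Fin 4) K) i 1 j) =
      (Pi.single i 1 : Fin 4 → K) j := fun j => by
    by_cases hj : j = i
    · subst hj; simp
    · simp [hj]
  simp only [formOfCoeff, pol, ofCoeff_apply, map_sum, ← Finset.sum_add_distrib]
  refine Finset.sum_congr rfl fun _ _ => Finset.sum_congr rfl fun _ _ =>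
    Finset.sum_congr rfl fun _ _ => ?_
  simp only [Derivation.leibniz, pderiv_C, pderiv_X, smul_eq_mul, map_add, map_mul, eval_C,
    eval_X, h, map_zero]
  ring

theorem restrictForm_formOfCoeff (a : Fin 4 → Fin 4 → Fin 4 → K) (u v : Fin 4 → K) :
    restrictForm (formOfCoeff a) u v = C (cub (ofCoeff a) u) * X 0 ^ 3 +
      C (pol (ofCoeff a) u v) * (X 0 ^ 2 * X 1) + C (pol (ofCoeff a) v u) * (X 0 * X 1 ^ 2) +
      C (cub (ofCoeff a) v) * X 1 ^ 3 := by
  simp only [restrictForm, formOfCoeff, cub, pol, ofCoeff_apply, map_sum, map_mul, map_add,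
    bind₁_C_right, bind₁_X_right, ← Finset.sum_add_distrib, Finset.sum_mul]
  refine Finset.sum_congr rfl fun _ _ => Finset.sum_congr rfl fun _ _ =>
    Finset.sum_congr rfl fun _ _ => ?_
  ring

/-- Each monomial is assigned to one ordering of its three variables; without symmetrization no
division by 6 occurs. -/
theorem exists_eq_formOfCoeff {F : MvPolynomial (Fin 4) K} (hF : F.IsHomogeneous 3) :
    ∃ a, F = formOfCoeff a := by
  rw [F.as_sum]
  refine Finset.sum_induction _ (fun F => ∃ a, F = formOfCoeff a) ?_ ⟨0, by simp [formOfCoeff]⟩ ?_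
  · rintro _ _ ⟨a, rfl⟩ ⟨b, rfl⟩
    exact ⟨a + b, by simp [formOfCoeff, add_mul, Finset.sum_add_distrib]⟩
  · intro m hm
    have hdeg := hF (mem_support_iff.1 hm)
    have hcard : Multiset.card (Finsupp.toMultiset m) = 3 := by
      rw [Finsupp.card_toMultiset, ← hdeg]
      simp [Finsupp.weight_apply]
      rfl
    obtain ⟨i, j, k, hijk⟩ := Multiset.card_eq_three.1 hcard
    have hm' : m = Finsupp.single i 1 + Finsupp.single j 1 + Finsupp.single k 1 := by
      rw [← Finsupp.toMultiset_toFinsupp m, hijk]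
      simp [Multiset.insert_eq_cons, ← Multiset.singleton_add, Multiset.toFinsupp_singleton,
        add_assoc]
    refine ⟨fun i' j' k' => if i' = i then if j' = j then if k' = k then coeff m F else 0 else 0
      else 0, ?_⟩
    have : monomial m (coeff m F) = C (coeff m F) * (X i * X j * X k) := by
      conv_lhs => rw [hm']
      rw [X, X, X, monomial_mul, monomial_mul, C_mul_monomial, ← hm']
      simp
    rw [this, formOfCoeff, Finset.sum_eq_single i, Finset.sum_eq_single j, Finset.sum_eq_single k]
    · simp
    all_goals simp +contextual

theorem binaryCubic_eq_zero {a b c d : K} (h : (C a * X 0 ^ 3 + C b * (X 0 ^ 2 * X 1) +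
    C c * (X 0 * X 1 ^ 2) + C d * X 1 ^ 3 : MvPolynomial (Fin 2) K) = 0) :
    a = 0 ∧ b = 0 ∧ c = 0 ∧ d = 0 := by
  have h' := congrArg (aeval ![(1 : Polynomial K), Polynomial.X]) h
  simp only [map_add, map_mul, map_pow, aeval_X, algHom_C, Matrix.cons_val_zero,
    Matrix.cons_val_one, Polynomial.algebraMap_eq, one_pow, mul_one, one_mul, map_zero] at h'
  have h0 := congrArg (Polynomial.coeff · 0) h'
  have h1 := congrArg (Polynomial.coeff · 1) h'
  have h2 := congrArg (Polynomial.coeff · 2) h'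
  have h3 := congrArg (Polynomial.coeff · 3) h'
  simp [Polynomial.coeff_C, Polynomial.coeff_X] at h0 h1 h2 h3
  exact ⟨h0, h1, h2, h3⟩

theorem lineInZeroLocus_iff (a : Fin 4 → Fin 4 → Fin 4 → K) (l : Submodule K (Fin 4 → K)) :
    LineInZeroLocus (formOfCoeff a) l ↔ LineOn (ofCoeff a) l := by
  refine ⟨fun h => ⟨h.1, fun x hx => ?_, fun x hx y hy => ?_⟩, fun h => ⟨h.1, fun x hx y hy => ?_⟩⟩
  · have := h.2 x hx x hx
    rw [restrictForm_formOfCoeff] at this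
    exact (binaryCubic_eq_zero this).1
  · have := h.2 x hx y hy
    rw [restrictForm_formOfCoeff] at this
    exact (binaryCubic_eq_zero this).2.1
  · rw [restrictForm_formOfCoeff, h.cub_eq x hx, h.cub_eq y hy, h.pol_eq x hx y hy,
      h.pol_eq y hy x hx]
    simp

end Coefficients

/-! ### Descent from the algebraic closure -/

section BaseChange

variable {K : Type w} (L : Type w) [Field K] [Field L] [Algebra K L]

/-- The inclusion of `K ^ 4` in `L ^ 4`. -/
def emb (x : Fin 4 → K) : Fin 4 → L := fun i => algebraMap K L (x i)

/-- The image in `L` of a family of coefficients in `K`. -/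
def mapCoeff (a : Fin 4 → Fin 4 → Fin 4 → K) : Fin 4 → Fin 4 → Fin 4 → L :=
  fun i j k => algebraMap K L (a i j k)

theorem map_formOfCoeff (a : Fin 4 → Fin 4 → Fin 4 → K) :
    (formOfCoeff a).map (algebraMap K L) = formOfCoeff (mapCoeff L a) := by
  simp only [formOfCoeff, mapCoeff, map_sum, map_mul, map_C, map_X]

variable (a : Fin 4 → Fin 4 → Fin 4 → K)

theorem emb_add (x y : Fin 4 → K) : emb L (x + y) = emb L x + emb L y := by
  ext i; simp [emb]

theorem emb_smul (c : K) (x : Fin 4 → K) : emb L (c • x) = algebraMap K L c • emb L x := by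
  ext i; simp [emb]

theorem emb_ne_zero {x : Fin 4 → K} (hx : x ≠ 0) : emb L x ≠ 0 := fun h => hx <| by
  ext i
  simpa [emb] using congrFun h i

theorem ofCoeff_emb (x y z : Fin 4 → K) :
    ofCoeff (mapCoeff L a) (emb L x) (emb L y) (emb L z) = algebraMap K L (ofCoeff a x y z) := by
  simp only [ofCoeff_apply, emb, mapCoeff, map_sum, map_mul]

theorem cub_emb (x : Fin 4 → K) :
    cub (ofCoeff (mapCoeff L a)) (emb L x) = algebraMap K L (cub (ofCoeff a) x) :=
  ofCoeff_emb L a x x x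

theorem pol_emb (x y : Fin 4 → K) :
    pol (ofCoeff (mapCoeff L a)) (emb L x) (emb L y) = algebraMap K L (pol (ofCoeff a) x y) := by
  simp only [pol, ofCoeff_emb, map_add]

theorem tri_emb (x y z : Fin 4 → K) : tri (ofCoeff (mapCoeff L a)) (emb L x) (emb L y) (emb L z) =
    algebraMap K L (tri (ofCoeff a) x y z) := by
  simp only [tri, ofCoeff_emb, map_add]

theorem disc_emb (x y z : Fin 4 → K) :
    disc (ofCoeff (mapCoeff L a)) (emb L x) (emb L y) (emb L z) =
      algebraMap K L (disc (ofCoeff a) x y z) := by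
  simp only [disc, cub_emb, pol_emb, tri_emb, map_add, map_sub, map_mul, map_pow, map_ofNat]

theorem exists_extend_functional (f : (Fin 4 → K) →ₗ[K] K) :
    ∃ g : (Fin 4 → L) →ₗ[L] L, ∀ x, g (emb L x) = algebraMap K L (f x) := by
  refine ⟨∑ i, algebraMap K L (f (Pi.single i 1)) • LinearMap.proj i, fun x => ?_⟩
  rw [LinearMap.pi_apply_eq_sum_univ f x, map_sum, LinearMap.sum_apply]
  refine Finset.sum_congr rfl fun i _ => ?_
  have hi : (fun j => if i = j then (1 : K) else 0) = Pi.single i 1 := by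
    ext j; simp [Pi.single_apply, eq_comm]
  simp [emb, hi, mul_comm, Algebra.smul_def]

/-- A functional over `K` separating `z` from `u` and `v` still separates them after extension of
scalars. -/
theorem emb_notMem_span_pair {u v z : Fin 4 → K} (h : z ∉ Submodule.span K {u, v}) :
    emb L z ∉ Submodule.span L {emb L u, emb L v} := by
  obtain ⟨f, hfz, hf⟩ := Submodule.exists_le_ker_of_notMem h
  obtain ⟨g, hg⟩ := exists_extend_functional L f
  have hu : f u = 0 := hf (Submodule.subset_span (by simp))
  have hv : f v = 0 := hf (Submodule.subset_span (by simp))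
  intro hm
  obtain ⟨a, b, hab⟩ := Submodule.mem_span_pair.1 hm
  have := congrArg g hab
  rw [map_add, map_smul, map_smul, hg, hg, hg, hu, hv] at this
  exact hfz (by simpa using this.symm)

theorem emb_pair {u v : Fin 4 → K} (hind : ∀ a b : K, a • u + b • v = 0 → a = 0 ∧ b = 0) :
    ∀ a b : L, a • emb L u + b • emb L v = 0 → a = 0 ∧ b = 0 := by
  have hv0 : v ≠ 0 := fun h => one_ne_zero (hind 0 1 (by simp [h])).2
  have h1 : u ∉ Submodule.span K {v, v} := fun h => by
    obtain ⟨a, b, hab⟩ := Submodule.mem_span_pair.1 h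
    exact one_ne_zero (hind 1 (-(a + b)) (by rw [← hab]; module)).1
  have h2 := emb_notMem_span_pair L h1
  intro a b h
  have ha : a = 0 := by
    by_contra ha
    refine h2 (Submodule.mem_span_pair.2 ⟨-(a⁻¹ * b), 0, ?_⟩)
    have : emb L u = a⁻¹ • (a • emb L u) := by rw [smul_smul, inv_mul_cancel₀ ha, one_smul]
    rw [this, eq_neg_of_add_eq_zero_left h]
    module
  subst ha
  exact ⟨rfl, by simpa [emb_ne_zero L hv0] using h⟩

variable {a}

theorem Smooth.descend (hS : Smooth (ofCoeff (mapCoeff L a))) : Smooth (ofCoeff a) := by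
  intro x hx0 hx
  by_contra! h
  refine hS.polHom_ne_zero (emb_ne_zero L hx0) (by rw [cub_emb, hx, map_zero]) ?_
  refine LinearMap.pi_ext' fun i => LinearMap.ext_ring ?_
  have he : (Pi.single i 1 : Fin 4 → L) = emb L (Pi.single i (1 : K)) := by
    ext j
    by_cases hj : j = i
    · subst hj; simp [emb]
    · simp [emb, hj]
  simp only [LinearMap.comp_apply, LinearMap.single_apply, LinearMap.zero_apply, he, polHom_apply,
    pol_emb, h, map_zero]

theorem LineOn.baseChange {k : Submodule K (Fin 4 → K)} (hk : LineOn (ofCoeff a) k) {u v : Fin 4 → K}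
    (hu : u ∈ k) (hv : v ∈ k) (hind : ∀ a b : K, a • u + b • v = 0 → a = 0 ∧ b = 0) :
    LineOn (ofCoeff (mapCoeff L a)) (Submodule.span L {emb L u, emb L v}) := by
  refine lineOn_span_pair (emb_pair L hind) ?_ ?_ ?_ ?_
  · rw [cub_emb, hk.cub_eq u hu, map_zero]
  · rw [pol_emb, hk.pol_eq u hu v hv, map_zero]
  · rw [pol_emb, hk.pol_eq v hv u hu, map_zero]
  · rw [cub_emb, hk.cub_eq v hv, map_zero]

theorem LineOn.eq_span_pair {k : Submodule K (Fin 4 → K)} (hk : LineOn (ofCoeff a) k)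
    {u v : Fin 4 → K} (hu : u ∈ k) (hv : v ∈ k)
    (hind : ∀ a b : K, a • u + b • v = 0 → a = 0 ∧ b = 0) : Submodule.span K {u, v} = k := by
  refine le_antisymm (Submodule.span_le.2
    (Set.insert_subset hu (Set.singleton_subset_iff.2 hv))) fun x hx => ?_
  obtain ⟨a, b, rfl⟩ := exists_eq_of_finrank_eq_two hk.finrank_eq hu hv hind x hx
  exact Submodule.mem_span_pair.2 ⟨a, b, rfl⟩

theorem exists_algebraMap_eval_ne_zero (hK : 13 ≤ Cardinal.mk K) {f : Polynomial L} (hf : f ≠ 0)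
    (hdeg : f.natDegree < 13) : ∃ t : K, f.eval (algebraMap K L t) ≠ 0 := by
  classical
  by_contra! h
  have hroot : ∀ t : K, algebraMap K L t ∈ f.roots.toFinset := fun t => by simp [hf, h t]
  have hinj : Function.Injective fun t : K => (⟨_, hroot t⟩ : f.roots.toFinset) := fun s t hst =>
    (algebraMap K L).injective (congrArg Subtype.val hst)
  have h1 := hK.trans (Cardinal.mk_le_of_injective hinj)
  rw [Cardinal.mk_coe_finset] at h1
  have h2 : 13 ≤ f.roots.toFinset.card := by exact_mod_cast h1
  have h3 := (Multiset.toFinset_card_le f.roots).trans f.card_roots'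
  omega

/-- Smoothness over the closure makes the discriminant polynomial nonzero over `L`; its values at
points of `K` are discriminants over `K`, so a non-root in `K` gives a good `K`-point. -/
theorem Smooth.ample [IsAlgClosed L] (hS : Smooth (ofCoeff (mapCoeff L a)))
    (hK : 13 ≤ Cardinal.mk K) : Ample (ofCoeff a) := by
  have h4 : finrank K (Fin 4 → K) = 4 := by simp
  have h4' : finrank L (Fin 4 → L) = 4 := by simp
  have hSK := hS.descend L
  refine ⟨h4, hSK, fun k hk y hy => ?_, fun k hk u hu v hv hind c₀ c₁ hc => ?_⟩
  · by_contra! h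
    obtain ⟨x, hx, hx0⟩ := exists_mem_ker_of_finrank_eq_two hk.finrank_eq (0 : _ →ₗ[K] K)
    obtain ⟨v, hv, -, hind⟩ := exists_basis_of_finrank_eq_two hk.finrank_eq hx hx0.1
    obtain ⟨z, hz, hzy⟩ := (hk.baseChange L hx hv hind).exists_pol_ne_zero h4' hS (y := emb L y)
      (emb_notMem_span_pair L (by rwa [hk.eq_span_pair hx hv hind]))
    obtain ⟨b, c, rfl⟩ := Submodule.mem_span_pair.1 hz
    have ht : tri (ofCoeff a) x v y = 0 := by
      have := pol_add_left (Φ := ofCoeff a) x v y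
      rw [h x hx, h v hv, h _ (k.add_mem hx hv)] at this
      simpa using this.symm
    apply hzy
    simp only [pol_add_left, pol_smul_left, tri_smul_left, tri_smul_mid, pol_emb, tri_emb, ht,
      h x hx, h v hv, map_zero]
    ring
  · have hu0 : u ≠ 0 := fun h => one_ne_zero (hind 1 0 (by simp [h])).1
    obtain ⟨z₀, hz₀⟩ := hSK u hu0 (hk.cub_eq u hu)
    obtain ⟨z₁, hz₁k, hz₁⟩ := exists_mem_ker_notMem h4 hk.finrank_eq (polHom (ofCoeff a) u)
    rw [polHom_apply] at hz₁
    have hkL := hk.baseChange L hu hv hind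
    have hindL := emb_pair L hind
    have huL : emb L u ∈ Submodule.span L {emb L u, emb L v} := Submodule.subset_span (by simp)
    have hvL : emb L v ∈ Submodule.span L {emb L u, emb L v} := Submodule.subset_span (by simp)
    obtain ⟨G, hG0, hGdeg, hG⟩ := hkL.exists_disc_polynomial h4' hS huL hvL
      (exists_eq_of_finrank_eq_two hkL.finrank_eq huL hvL hindL) hindL
      (z₀ := emb L z₀) (z₁ := emb L z₁) (by rw [pol_emb]; simpa using hz₀)
      (by rw [pol_emb, hz₁, map_zero])
      (emb_notMem_span_pair L (by rwa [hk.eq_span_pair hu hv hind]))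
    have hlin : (Polynomial.C (algebraMap K L c₁) * Polynomial.X +
        Polynomial.C (algebraMap K L c₀)) ≠ 0 := fun h => by
      have h0 := congrArg (Polynomial.coeff · 0) h
      have h1 := congrArg (Polynomial.coeff · 1) h
      simp [Polynomial.coeff_C] at h0 h1
      exact hc.elim (fun h => h h1) fun h => h h0
    have hlindeg : (Polynomial.C (algebraMap K L c₁) * Polynomial.X +
        Polynomial.C (algebraMap K L c₀)).natDegree ≤ 1 := by compute_degree
    -- Degree at most `1 + 10`: the linear condition and the discriminant.
    obtain ⟨t, ht⟩ := exists_algebraMap_eval_ne_zero L hK (mul_ne_zero hlin hG0)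
      (lt_of_le_of_lt (Polynomial.natDegree_mul_le_of_le hlindeg hGdeg) (by norm_num))
    rw [Polynomial.eval_mul, mul_ne_zero_iff, hG, ← emb_smul, ← emb_add, pol_emb, pol_emb,
      ← map_neg, ← emb_smul, ← emb_smul, ← emb_add, disc_emb] at ht
    refine ⟨t, fun h => ht.1 ?_, hk.good_of_disc_ne_zero h4 hSK hu hv
      (exists_eq_of_finrank_eq_two hk.finrank_eq hu hv hind) hind t ?_
      (fun h => ht.2 (by rw [h, map_zero]))⟩
    · simpa using congrArg (algebraMap K L) h
    · rw [pol_add_right, pol_smul_right, pol_smul_right]; ring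

end BaseChange

/-! ### Eckardt points -/

/-- The hypotheses on `y` make the residual conic singular at `p`. Over a closed field it splits
into two lines through `p`, different from each other and from `k` because no plane section contains
a double line. -/
theorem LineOn.exists_three_lines {K V : Type*} [Field K] [AddCommGroup V] [Module K V]
    {Φ : V →ₗ[K] V →ₗ[K] V →ₗ[K] K} {k : Submodule K V} [IsAlgClosed K] (h4 : finrank K V = 4)
    (hS : Smooth Φ) (hk : LineOn Φ k) {p u y : V} (hp : p ∈ k) (hu : u ∈ k)
    (hind : ∀ a b : K, a • p + b • u = 0 → a = 0 ∧ b = 0) (hy : y ∉ k) (hpy : pol Φ p y = 0)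
    (hpuy : tri Φ p u y = 0) (hyp : pol Φ y p = 0) :
    ∃ l : Fin 3 → Submodule K V, Function.Injective l ∧ ∀ j, LineOn Φ (l j) ∧ p ∈ l j := by
  have hp0 : p ≠ 0 := fun h => one_ne_zero (hind 1 0 (by simp [h])).1
  have hc : pol Φ u y ≠ 0 := by
    obtain ⟨x, hx, hxy⟩ := hk.exists_pol_ne_zero h4 hS hy
    obtain ⟨a, b, rfl⟩ := exists_eq_of_finrank_eq_two hk.finrank_eq hp hu hind x hx
    intro h
    apply hxy
    simp only [pol_add_left, pol_smul_left, tri_smul_left, tri_smul_mid, hpy, hpuy, h]; ring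
  obtain ⟨t, ht⟩ := exists_root_quadratic hc (pol Φ y u) (cub Φ y)
  have hder := hk.derivative_root_ne_zero h4 hS hp hu hind hy hpy hpuy hyp ht
  obtain ⟨t', ht'⟩ : ∃ t', pol Φ u y * (t' + t) + pol Φ y u = 0 :=
    ⟨-pol Φ y u / pol Φ u y - t, by field_simp; ring⟩
  have hroot' : pol Φ u y * t' ^ 2 + pol Φ y u * t' + cub Φ y = 0 := by
    linear_combination ht + (t' - t) * ht'
  have hne : t' - t ≠ 0 := fun h => hder (by linear_combination ht' - pol Φ u y * h)
  have hmem : ∀ s : K, s • u + y ∉ k := fun s h => hy (by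
    rwa [k.add_mem_iff_right (k.smul_mem _ hu)] at h)
  have hself : ∀ s : K, s • u + y ∈ Submodule.span K {p, s • u + y} := fun s =>
    Submodule.subset_span (by simp)
  have hdist : Submodule.span K {p, t • u + y} ≠ Submodule.span K {p, t' • u + y} := fun h => by
    have h1 := hself t'
    rw [← h, Submodule.mem_span_pair] at h1
    obtain ⟨a, b, hab⟩ := h1
    by_cases hb : b = 1
    · subst hb
      exact hne (neg_eq_zero.1 (hind a (-(t' - t)) (by
        have h2 : a • p + (t - t') • u = (a • p + (1 : K) • (t • u + y)) - (t' • u + y) := by module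
        rw [neg_sub, h2, hab, sub_self])).2)
    · refine hy ((k.smul_mem_iff (sub_ne_zero.2 hb)).1 ?_)
      have h2 : (b - 1) • y = (t' - b * t) • u - a • p +
          ((a • p + b • (t • u + y)) - (t' • u + y)) := by module
      rw [h2, hab, sub_self, add_zero]
      exact k.sub_mem (k.smul_mem _ hu) (k.smul_mem _ hp)
  have hd1 : ∀ s : K, Submodule.span K {p, s • u + y} ≠ k := fun s h => hmem s (h ▸ hself s)
  refine ⟨![k, Submodule.span K {p, t • u + y}, Submodule.span K {p, t' • u + y}], ?_, ?_⟩
  · intro i j hij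
    fin_cases i <;> fin_cases j <;> first | rfl | skip
    · exact (hd1 t hij.symm).elim
    · exact (hd1 t' hij.symm).elim
    · exact (hd1 t hij).elim
    · exact (hdist hij).elim
    · exact (hd1 t' hij).elim
    · exact (hdist hij.symm).elim
  · have hpl : ∀ s : K, p ∈ Submodule.span K {p, s • u + y} := fun s =>
      Submodule.subset_span (by simp)
    intro j
    fin_cases j
    · exact ⟨hk, hp⟩
    · exact ⟨hk.lineOn_of_root hp hp0 hu hy hpy hpuy hyp ht, hpl t⟩
    · exact ⟨hk.lineOn_of_root hp hp0 hu hy hpy hpuy hyp hroot', hpl t'⟩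

theorem LineOn.exists_three_lines_of_not_nonEckardt {K L : Type w} [Field K] [Field L]
    [Algebra K L] [IsAlgClosed L] {a : Fin 4 → Fin 4 → Fin 4 → K}
    (hS : Smooth (ofCoeff (mapCoeff L a))) {k : Submodule K (Fin 4 → K)}
    (hk : LineOn (ofCoeff a) k) {p : Fin 4 → K} (hp : p ∈ k) (hp0 : p ≠ 0)
    (h : ¬ NonEckardt (ofCoeff a) p) :
    ∃ l : Fin 3 → Submodule L (Fin 4 → L), Function.Injective l ∧
      ∀ j, LineOn (ofCoeff (mapCoeff L a)) (l j) ∧ emb L p ∈ l j := by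
  have h' : ∀ y, pol (ofCoeff a) p y = 0 → pol (ofCoeff a) y p = 0 := fun y hy => by
    by_contra hne
    exact h ⟨y, hy, hne⟩
  obtain ⟨u, hu, -, hind⟩ := exists_basis_of_finrank_eq_two hk.finrank_eq hp hp0
  obtain ⟨y, hy, hpy⟩ := exists_mem_ker_notMem (by simp) hk.finrank_eq (polHom (ofCoeff a) p)
  rw [polHom_apply] at hpy
  have hyp := h' y hpy
  -- The direction `u + y` is tangent too, and it yields the vanishing of the mixed term `tri p u
  -- y`.
  have ht := h' (u + y) (by rw [pol_add_right, hk.pol_eq p hp u hu, hpy, add_zero])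
  rw [pol_add_left, hk.pol_eq u hu p hp, hyp, zero_add, zero_add, tri_comm_right,
    tri_comm_left] at ht
  refine (hk.baseChange L hp hu hind).exists_three_lines (y := emb L y) (by simp) hS
    (Submodule.subset_span (by simp)) (Submodule.subset_span (by simp)) (emb_pair L hind)
    (emb_notMem_span_pair L (by rwa [hk.eq_span_pair hp hu hind])) ?_ ?_ ?_
  · rw [pol_emb, hpy, map_zero]
  · rw [tri_emb, ht, map_zero]
  · rw [pol_emb, hyp, map_zero]

end Trilinear

/-! ### The secant and tangent process on the surface -/

namespace SmoothCubicSurface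

open Trilinear

variable {K : Type*} [Field K] (S : SmoothCubicSurface K)

theorem iterate_subset_points {B : Set (ProjSpace3 K)} (hB : B ⊆ S.points) (n : ℕ) :
    S.secantTangentStep^[n] B ⊆ S.points := by
  cases n with
  | zero => exact hB
  | succ n =>
    rw [Function.iterate_succ_apply']
    exact fun R hR => hR.1

theorem monotone_iterate {B : Set (ProjSpace3 K)} (hB : B ⊆ S.points) :
    Monotone fun n => S.secantTangentStep^[n] B := by
  refine monotone_nat_of_le_succ fun n R hR => ?_
  rw [Function.iterate_succ_apply']
  exact ⟨S.iterate_subset_points hB n hR, Or.inl hR⟩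

theorem subset_span (B : Set (ProjSpace3 K)) : B ⊆ S.secantTangentSpan B :=
  fun _ hP => Set.mem_iUnion.2 ⟨0, hP⟩

theorem span_subset_points {B : Set (ProjSpace3 K)} (hB : B ⊆ S.points) :
    S.secantTangentSpan B ⊆ S.points :=
  Set.iUnion_subset (S.iterate_subset_points hB)

theorem span_empty : S.secantTangentSpan ∅ = ∅ := by
  refine Set.iUnion_eq_empty.2 fun n => ?_
  induction n with
  | zero => rfl
  | succ n ih =>
    rw [Function.iterate_succ_apply', ih]
    refine Set.eq_empty_of_forall_notMem fun R hR => ?_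
    obtain ⟨-, h | ⟨-, -, -, P, hP, -⟩⟩ := hR
    · exact h
    · exact hP

theorem mem_span_of_cycle {B : Set (ProjSpace3 K)} (hB : B ⊆ S.points) {P Q R : ProjSpace3 K}
    (hP : P ∈ S.secantTangentSpan B) (hQ : Q ∈ S.secantTangentSpan B) (hR : R ∈ S.points)
    {l : Submodule K (Fin 4 → K)} (hl : IsLine l) (hlS : ¬ S.ContainsLine l)
    (h : S.IntersectionCycle l P Q R) : R ∈ S.secantTangentSpan B := by
  obtain ⟨m, hm⟩ := Set.mem_iUnion.1 hP
  obtain ⟨n, hn⟩ := Set.mem_iUnion.1 hQ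
  refine Set.mem_iUnion.2 ⟨max m n + 1, ?_⟩
  rw [Function.iterate_succ_apply']
  exact ⟨hR, Or.inr ⟨l, hl, hlS, P, S.monotone_iterate hB (le_max_left m n) hm, Q,
    S.monotone_iterate hB (le_max_right m n) hn, h⟩⟩

variable {S} {a : Fin 4 → Fin 4 → Fin 4 → K}

theorem mk_mem_points (ha : S.form = formOfCoeff a) {x : Fin 4 → K} (hx : x ≠ 0) :
    Projectivization.mk K x hx ∈ S.points ↔ cub (ofCoeff a) x = 0 := by
  obtain ⟨c, hc⟩ := Projectivization.exists_smul_eq_mk_rep K x hx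
  rw [points, Set.mem_ofPred_eq, ha, eval_formOfCoeff, ← hc, Units.smul_def, cub_smul]
  simp

theorem mem_points_iff (ha : S.form = formOfCoeff a) (P : ProjSpace3 K) :
    P ∈ S.points ↔ cub (ofCoeff a) P.rep = 0 := by
  rw [points, Set.mem_ofPred_eq, ha, eval_formOfCoeff]

theorem exists_rep_eq_smul {x : Fin 4 → K} (hx : x ≠ 0) :
    ∃ c : K, c ≠ 0 ∧ (Projectivization.mk K x hx).rep = c • x := by
  obtain ⟨c, hc⟩ := Projectivization.exists_smul_eq_mk_rep K x hx
  exact ⟨c, c.ne_zero, hc.symm⟩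

/-! ### Secants and tangents as intersection cycles -/

theorem pair_of_pol_ne_zero {x y : Fin 4 → K} (hx : cub (ofCoeff a) x = 0)
    (hy : cub (ofCoeff a) y = 0) (hne : pol (ofCoeff a) x y ≠ 0 ∨ pol (ofCoeff a) y x ≠ 0) :
    ∀ s t : K, s • x + t • y = 0 → s = 0 ∧ t = 0 := by
  intro s t h
  have h1 := congrArg (pol (ofCoeff a) x) h
  have h2 := congrArg (pol (ofCoeff a) y) h
  rw [pol_add_right, pol_smul_right, pol_smul_right, pol_self, hx, pol_zero_right] at h1
  rw [pol_add_right, pol_smul_right, pol_smul_right, pol_self, hy, pol_zero_right] at h2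
  have hx0 : x ≠ 0 := by rintro rfl; simp [pol_zero_left, pol_zero_right] at hne
  have hy0 : y ≠ 0 := by rintro rfl; simp [pol_zero_left, pol_zero_right] at hne
  rcases hne with hne | hne
  · have ht : t = 0 := by simpa [hne] using h1
    subst ht
    exact ⟨by simpa [hx0] using h, rfl⟩
  · have hs : s = 0 := by simpa [hne] using h2
    subst hs
    exact ⟨rfl, by simpa [hy0] using h⟩

theorem secant_line (ha : S.form = formOfCoeff a) {x y : Fin 4 → K} (hx : cub (ofCoeff a) x = 0)
    (hy : cub (ofCoeff a) y = 0) (hne : pol (ofCoeff a) x y ≠ 0 ∨ pol (ofCoeff a) y x ≠ 0) :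
    LinearIndependent K ![x, y] ∧ IsLine (Submodule.span K {x, y}) ∧
      ¬ S.ContainsLine (Submodule.span K {x, y}) := by
  have hind := LinearIndependent.pair_iff.2 (pair_of_pol_ne_zero hx hy hne)
  refine ⟨hind, ?_, fun h => ?_⟩
  · have := finrank_span_eq_card hind
    rwa [Matrix.range_cons_cons_empty, Fintype.card_fin] at this
  · rw [ContainsLine, ha, lineInZeroLocus_iff] at h
    have hxm : x ∈ Submodule.span K {x, y} := Submodule.subset_span (by simp)
    have hym : y ∈ Submodule.span K {x, y} := Submodule.subset_span (by simp)
    exact hne.elim (fun hne => hne (h.pol_eq x hxm y hym)) fun hne => hne (h.pol_eq y hym x hxm)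

/-- On a secant the form is `st (s pol x y + t pol y x)`, and on a tangent `st² pol y x`; their
linear factors are the required cycles. The scalars relating representatives to `x` and `y` are
absorbed into the constant. -/
theorem secantClosed_span (ha : S.form = formOfCoeff a) {B : Set (ProjSpace3 K)}
    (hB : B ⊆ S.points) : SecantClosed (ofCoeff a)
      fun x => ∃ hx : x ≠ 0, Projectivization.mk K x hx ∈ S.secantTangentSpan B := by
  have hsmul : ∀ {x : Fin 4 → K} {c : K},
      (∃ hx : x ≠ 0, Projectivization.mk K x hx ∈ S.secantTangentSpan B) → c ≠ 0 →
      ∃ hx : c • x ≠ 0, Projectivization.mk K (c • x) hx ∈ S.secantTangentSpan B := by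
    rintro x c ⟨hx, h⟩ hc
    refine ⟨smul_ne_zero hc hx, ?_⟩
    convert h using 1
    exact (Projectivization.mk_eq_mk_iff' K _ _ _ _).2 ⟨c, rfl⟩
  have hcub : ∀ {x : Fin 4 → K},
      (∃ hx : x ≠ 0, Projectivization.mk K x hx ∈ S.secantTangentSpan B) →
      cub (ofCoeff a) x = 0 := fun ⟨hx, h⟩ =>
    (mk_mem_points ha hx).1 (S.span_subset_points hB h)
  refine ⟨fun h => h.1, hcub, hsmul, ?_, ?_⟩
  · rintro x y s t hBx hBy hr hcr hne
    -- With a zero coefficient the point is one of the two given ones, and no construction is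
    -- needed.
    by_cases hs : s = 0
    · subst hs
      rw [zero_smul, zero_add] at hr ⊢
      exact hsmul hBy fun h => hr (by rw [h, zero_smul])
    by_cases ht : t = 0
    · subst ht
      rw [zero_smul, add_zero] at hr ⊢
      exact hsmul hBx hs
    have hcx := hcub hBx
    have hcy := hcub hBy
    obtain ⟨hind, hline, hnot⟩ := secant_line ha hcx hcy hne
    obtain ⟨hx, hPx⟩ := hBx
    obtain ⟨hy, hPy⟩ := hBy
    obtain ⟨p, hp0, hp⟩ := exists_rep_eq_smul hx
    obtain ⟨q, hq0, hq⟩ := exists_rep_eq_smul hy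
    obtain ⟨r, hr0, hrep⟩ := exists_rep_eq_smul hr
    have hrel : s * pol (ofCoeff a) x y + t * pol (ofCoeff a) y x = 0 := by
      refine (mul_eq_zero.1 ?_).resolve_left (mul_ne_zero hs ht)
      rw [← hcr]
      simp only [cub_add, cub_smul, pol_smul_left, pol_smul_right, hcx, hcy]; ring
    have hyx : pol (ofCoeff a) y x ≠ 0 := fun h0 => by
      rw [h0, mul_zero, add_zero, mul_eq_zero] at hrel
      exact hne.elim (fun h => h (hrel.resolve_left hs)) fun h => h h0
    refine ⟨hr, S.mem_span_of_cycle hB hPx hPy ((mk_mem_points ha hr).2 hcr) hline hnot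
      ⟨x, y, hind, rfl, ![p, 0], ![0, q], ![r * s, r * t], by simp [hp], by simp [hq], ?_,
      pol (ofCoeff a) y x / (p * q * r * s), by positivity, ?_⟩⟩
    · rw [hrep]; simp [smul_smul]
    · rw [ha, restrictForm_formOfCoeff, hcx, hcy]
      obtain ⟨c, hc⟩ : ∃ c, c = pol (ofCoeff a) y x / (p * q * r * s) := ⟨_, rfl⟩
      have h1 : pol (ofCoeff a) y x = c * p * q * (r * s) := by rw [hc]; field_simp
      have h2 : pol (ofCoeff a) x y = -(c * p * q * (r * t)) := by
        refine mul_left_cancel₀ hs ?_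
        linear_combination hrel - t * h1
      rw [← hc, h1, h2]
      simp only [Matrix.cons_val_zero, Matrix.cons_val_one, map_zero, map_mul, map_neg]
      ring
  · rintro x y hBx hy hcy hxy hyx
    have hcx := hcub hBx
    obtain ⟨hind, hline, hnot⟩ := secant_line ha hcx hcy (Or.inr hyx)
    obtain ⟨hx, hPx⟩ := hBx
    obtain ⟨p, hp0, hp⟩ := exists_rep_eq_smul hx
    obtain ⟨r, hr0, hr⟩ := exists_rep_eq_smul hy
    refine ⟨hy, S.mem_span_of_cycle hB hPx hPx ((mk_mem_points ha hy).2 hcy) hline hnot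
      ⟨x, y, hind, rfl, ![p, 0], ![p, 0], ![0, r], by simp [hp], by simp [hp], by simp [hr],
      pol (ofCoeff a) y x / (p ^ 2 * r), by positivity, ?_⟩⟩
    rw [ha, restrictForm_formOfCoeff, hcx, hcy, hxy]
    obtain ⟨c, hc⟩ : ∃ c, c = pol (ofCoeff a) y x / (p ^ 2 * r) := ⟨_, rfl⟩
    have h1 : pol (ofCoeff a) y x = c * p ^ 2 * r := by rw [hc]; field_simp
    rw [← hc, h1]
    simp only [Matrix.cons_val_zero, Matrix.cons_val_one, map_zero, map_mul, map_pow]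
    ring

theorem smooth_mapCoeff (ha : S.form = formOfCoeff a) :
    Trilinear.Smooth (ofCoeff (mapCoeff (AlgebraicClosure K) a)) := by
  intro x hx0 hx
  have hmap : ∀ F : MvPolynomial (Fin 4) K,
      aeval x F = eval x (F.map (algebraMap K (AlgebraicClosure K))) := fun F => by
    rw [eval_map, aeval_def]
  obtain ⟨i, hi⟩ := S.smooth x hx0 (by rw [hmap, ha, map_formOfCoeff, eval_formOfCoeff, hx])
  rw [hmap, ← pderiv_map, ha, map_formOfCoeff, eval_pderiv_formOfCoeff] at hi
  exact ⟨_, hi⟩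

theorem span_singleton_eq_points (ha : S.form = formOfCoeff a) (hK : 13 ≤ Cardinal.mk K)
    {l l' : Submodule K (Fin 4 → K)} (hl : S.ContainsLine l) (hl' : S.ContainsLine l')
    (hskew : Disjoint l l') {p : Fin 4 → K} (hp : p ∈ l) (hp0 : p ≠ 0)
    (hne : NonEckardt (ofCoeff a) p) :
    S.secantTangentSpan {Projectivization.mk K p hp0} = S.points := by
  rw [ContainsLine, ha, lineInZeroLocus_iff] at hl hl'
  have hsub : {Projectivization.mk K p hp0} ⊆ S.points :=
    Set.singleton_subset_iff.2 ((mk_mem_points ha hp0).2 (hl.cub_eq p hp))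
  have hgen := hne.generates (secantClosed_span ha hsub) ((smooth_mapCoeff ha).ample _ hK) hK
    hl hl' hskew hp ⟨hp0, S.subset_span _ rfl⟩
  refine (S.span_subset_points hsub).antisymm fun R hR => ?_
  obtain ⟨hR0, h⟩ := hgen R.rep R.rep_nonzero ((mem_points_iff ha R).1 hR)
  rwa [Projectivization.mk_rep] at h

theorem nonEckardt_rep (ha : S.form = formOfCoeff a) {l : Submodule K (Fin 4 → K)}
    (hl : S.ContainsLine l) {P : ProjSpace3 K} (hPl : P.rep ∈ l) (hP : ¬ S.IsEckardt P) :
    NonEckardt (ofCoeff a) P.rep := by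
  by_contra hne
  rw [ContainsLine, ha, lineInZeroLocus_iff] at hl
  obtain ⟨m, hinj, hm⟩ := hl.exists_three_lines_of_not_nonEckardt
    (smooth_mapCoeff ha) hPl P.rep_nonzero hne
  refine hP ⟨m, hinj, fun j => ⟨?_, (hm j).2⟩⟩
  rw [ha, map_formOfCoeff, lineInZeroLocus_iff]
  exact (hm j).1

theorem mordellWeilRank_eq_one {P : ProjSpace3 K} (hP : P ∈ S.points)
    (h : S.secantTangentSpan {P} = S.points) : S.mordellWeilRank = 1 := by
  have hmem : (1 : Cardinal) ∈ {c | ∃ B : Set (ProjSpace3 K), B ⊆ S.points ∧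
      S.secantTangentSpan B = S.points ∧ Cardinal.mk B = c} :=
    ⟨{P}, Set.singleton_subset_iff.2 hP, h, Cardinal.mk_singleton P⟩
  refine le_antisymm (csInf_le' hmem) (le_csInf ⟨1, hmem⟩ ?_)
  rintro c ⟨B, -, hB, rfl⟩
  refine Cardinal.one_le_iff_ne_zero.2 fun h0 => ?_
  rw [Cardinal.mk_eq_zero_iff, Set.isEmpty_coe_sort] at h0
  rw [h0, S.span_empty] at hB
  exact (hB ▸ hP : P ∈ (∅ : Set (ProjSpace3 K)))

end SmoothCubicSurface

theorem theorem1 {K : Type*} [Field K] (hK : 13 ≤ Cardinal.mk K) (S : SmoothCubicSurface K)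
    (l l' : Submodule K (Fin 4 → K)) (hl : S.ContainsLine l) (hl' : S.ContainsLine l')
    (hskew : Disjoint l l') :
    (∀ P : ProjSpace3 K, P ∈ S.points → (P.submodule ≤ l ∨ P.submodule ≤ l') →
      ¬ S.IsEckardt P → S.secantTangentSpan {P} = S.points) ∧
    S.mordellWeilRank = 1 := by
  obtain ⟨a, ha⟩ := Trilinear.exists_eq_formOfCoeff S.homogeneous
  refine ⟨fun P _ hPl hP => ?_, ?_⟩
  · rw [Projectivization.submodule_eq, Submodule.span_singleton_le_iff_mem,
      Submodule.span_singleton_le_iff_mem] at hPl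
    rw [← P.mk_rep]
    rcases hPl with hPl | hPl
    · exact SmoothCubicSurface.span_singleton_eq_points ha hK hl hl' hskew hPl P.rep_nonzero
        (SmoothCubicSurface.nonEckardt_rep ha hl hPl hP)
    · exact SmoothCubicSurface.span_singleton_eq_points ha hK hl' hl hskew.symm hPl P.rep_nonzero
        (SmoothCubicSurface.nonEckardt_rep ha hl' hPl hP)
  · have hl₁ := hl
    rw [SmoothCubicSurface.ContainsLine, ha, Trilinear.lineInZeroLocus_iff] at hl₁
    -- The rank needs some non-Eckardt `K`-point on `l`; a good point is one.
    obtain ⟨p, hp⟩ := Trilinear.exists_good ((SmoothCubicSurface.smooth_mapCoeff ha).ample _ hK) hl₁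
    exact SmoothCubicSurface.mordellWeilRank_eq_one
      ((SmoothCubicSurface.mk_mem_points ha hp.ne_zero).2 (hl₁.cub_eq p hp.mem))
      (SmoothCubicSurface.span_singleton_eq_points ha hK hl hl' hskew hp.mem hp.ne_zero
        hp.nonEckardt)
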